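/- \textbf{Corollary 1 (Variance reduction).} Let $K, M\ge 1$ and $d\ge 0$. For each sample size $n$ and each unit $i\in\{1,\dots,n\}$ let $Y_i(1),\dots,Y_i(K)\in\mathbb R$ be potential outcomes, $S_i\in\{1,\dots,M\}$ a stratum, $X_i\in\mathbb R^{d}$ covariates, $W_i\in\{1,\dots,K\}$ the treatment received and $Y_i=Y_i(W_i)$ the observed outcome (all of these may depend on $n$). Put $n(s)=\#\{i:S_i=s\}$, $n_w(s)=\#\{i: W_i=w,\ S_i=s\}$ and $\widehat\pi_w(s)=n_w(s)/n(s)$. Assume: (i) for each $n$ the vectors $(Y_i(1),\dots,Y_i(K),S_i,X_i)$, $i=1,\dots,n$, are i.i.d. with a law that does not depend on $n$, and $P(S_i=s)>0$ for every $s$; (ii) for each $n$, $\{Y_i(1),\dots,Y_i(K),X_i\}_{i=1}^n$ and $\{W_i\}_{i=1}^n$ are conditionally independent given $\{S_i\}_{i=1}^n$; (iii) $\widehat\pi_w(s)\to\pi_w(s)$ in probability as $n\to\infty$ for all $w,s$, where $\pi_w(s)\in(0,1)$ are the target assignment probabilities. For treatments $w,w'$ and $y\in\mathbb R$ let $\Delta_{w,w'}(y)=P(Y(w)\le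 y)-P(Y(w')\le y)$ be the distributional treatment effect (DTE), and let $\mu_w(y,s,x)=P(Y(w)\le y\mid S=s,X=x)$. The empirical (IPW) DTE estimator is $$\widehat\Delta^{emp}_{w,w'}(y)=\widehat F^{emp}_{w}(y)-\widehat F^{emp}_{w'}(y),\qquad \widehat F^{emp}_{w}(y)=\frac1n\sum_{i=1}^n\frac{1\{W_i=w\}\,1\{Y_i\le y\}}{\widehat\pi_w(S_i)},$$ and the regression-adjusted DTE estimator with known adjustment terms is $$\widetilde\Delta^{adj}_{w,w'}(y)=\widetilde F^{adj}_{w}(y)-\widetilde F^{adj}_{w'}(y),\qquad \widetilde F^{adj}_{w}(y)=\frac1n\sum_{i=1}^n\Big[\frac{1\{W_i=w\}\,(1\{Y_i\le y\}-\mu_w(y,S_i,X_i))}{\widehat\pi_w(S_i)}+\mu_w(y,S_i,X_i)\Big],$$ where a summand fraction with $\widehat\pi_w(S_i)=0$ (hence $W_i\neq w$) is read as $0$. Then for all $w,w'$ and every $y$ both estimators are asymptotically normal and the adjusted one has the smaller asymptotic variance: there are $V^{adj},V^{emp}\ge 0$ such that, as $n\to\infty$, $$\sqrt n\big(\widetilde\Delta^{adj}_{w,w'}(y)-\Delta_{w,w'}(y)\big)\xrightarrow{d}N(0,V^{adj}),\qquad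 \sqrt n\big(\widehat\Delta^{emp}_{w,w'}(y)-\Delta_{w,w'}(y)\big)\xrightarrow{d}N(0,V^{emp}),$$ and $V^{adj}\le V^{emp}$ (where $N(0,0)$ is the point mass at $0$). -/

import Mathlib

open MeasureTheory ProbabilityTheory Filter Topology
open scoped NNReal ENNReal

namespace CAR

/-- The characteristics `(Y(1), …, Y(K), S, X)` of one unit: potential outcomes under the `K`
treatments, stratum (one of `M`), and extra covariates in `ℝ^d`. -/
abbrev UnitData (K M d : ℕ) : Type := (Fin K → ℝ) × Fin M × (Fin d → ℝ)

/-- The raw random variables of a sequence of experiments, one for each sample size `n`: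
`pot n i w` is the potential outcome `Y_i(w)`, `strat n i` the stratum `S_i`, `cov n i` the
covariate vector `X_i` and `treat n i` the treatment `W_i` of unit `i` in the sample of size `n`.
Everything may depend on `n`, as the assignments do in stratified block randomization. -/
structure Experiment (Ω : Type*) (K M d : ℕ) where
  pot : (n : ℕ) → Fin n → Fin K → Ω → ℝ
  strat : (n : ℕ) → Fin n → Ω → Fin M
  cov : (n : ℕ) → Fin n → Ω → (Fin d → ℝ)
  treat : (n : ℕ) → Fin n → Ω → Fin K

noncomputable section

variable {Ω : Type*} {K M d : ℕ}

namespace Experiment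

/-- `(Y_i(1), …, Y_i(K), S_i, X_i)`. -/
def unit (E : Experiment Ω K M d) (n : ℕ) (i : Fin n) (ω : Ω) : UnitData K M d :=
  (fun w => E.pot n i w ω, E.strat n i ω, E.cov n i ω)

/-- The observed outcome `Y_i = Y_i(W_i)`. -/
def obs (E : Experiment Ω K M d) (n : ℕ) (i : Fin n) (ω : Ω) : ℝ :=
  E.pot n i (E.treat n i ω) ω

/-- `n(s)`, the number of units in stratum `s`. -/
def nStrat (E : Experiment Ω K M d) (n : ℕ) (s : Fin M) (ω : Ω) : ℕ :=
  (Finset.univ.filter fun i : Fin n => E.strat n i ω = s).card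

/-- `n_w(s)`, the number of units in stratum `s` that receive treatment `w`. -/
def nTreat (E : Experiment Ω K M d) (n : ℕ) (w : Fin K) (s : Fin M) (ω : Ω) : ℕ :=
  (Finset.univ.filter fun i : Fin n => E.treat n i ω = w ∧ E.strat n i ω = s).card

/-- The empirical assignment probability `π̂_w(s) = n_w(s) / n(s)` (`0` on an empty stratum). -/
def piHat (E : Experiment Ω K M d) (n : ℕ) (w : Fin K) (s : Fin M) (ω : Ω) : ℝ :=
  (E.nTreat n w s ω : ℝ) / (E.nStrat n s ω : ℝ)

/-- The regression-adjusted (augmented inverse propensity weighted) estimator of the distribution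
function `F_{Y(w)}(y)`, with `m s x` in the place of the adjustment term `μ_w(y, s, x)`.
If `π̂_w(S_i) = 0`, then `W_i ≠ w`, and the fraction is read as `0`. -/
def cdfAIPW (E : Experiment Ω K M d) (m : Fin M → (Fin d → ℝ) → ℝ) (n : ℕ) (w : Fin K) (y : ℝ)
    (ω : Ω) : ℝ :=
  (1 / (n : ℝ)) * ∑ i : Fin n,
    ((if E.treat n i ω = w then (1 : ℝ) else 0)
        * ((if E.obs n i ω ≤ y then (1 : ℝ) else 0) - m (E.strat n i ω) (E.cov n i ω))
        / E.piHat n w (E.strat n i ω) ω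
      + m (E.strat n i ω) (E.cov n i ω))

/-- The empirical (inverse propensity weighted) estimator of `F_{Y(w)}(y)`. -/
def cdfEmp (E : Experiment Ω K M d) (n : ℕ) (w : Fin K) (y : ℝ) (ω : Ω) : ℝ :=
  (1 / (n : ℝ)) * ∑ i : Fin n,
    (if E.treat n i ω = w then (1 : ℝ) else 0) * (if E.obs n i ω ≤ y then (1 : ℝ) else 0)
      / E.piHat n w (E.strat n i ω) ω

end Experiment

/-- `F_{Y(w)}(y)`, where `Q` is the law of the characteristics of a unit. -/
def popCDF (Q : Measure (UnitData K M d)) (w : Fin K) (y : ℝ) : ℝ :=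
  Q.real {u | u.1 w ≤ y}

/-- The distributional treatment effect `F_{Y(w)}(y) - F_{Y(w')}(y)`. -/
def dte (Q : Measure (UnitData K M d)) (w w' : Fin K) (y : ℝ) : ℝ :=
  popCDF Q w y - popCDF Q w' y

/-- The conditional distribution function `μ_w(y, s, x) = P(Y(w) ≤ y | S = s, X = x)`. -/
def condCDF (Q : Measure (UnitData K M d)) [IsFiniteMeasure Q] (w : Fin K) (y : ℝ)
    (s : Fin M) (x : Fin d → ℝ) : ℝ :=
  (condDistrib (fun u : UnitData K M d => u.1 w) (fun u : UnitData K M d => u.2) Q (s, x)).real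
    (Set.Iic y)

namespace Experiment

/-- The empirical estimator of the distributional treatment effect. -/
def dteEmp (E : Experiment Ω K M d) (w w' : Fin K) (y : ℝ) (n : ℕ) (ω : Ω) : ℝ :=
  E.cdfEmp n w y ω - E.cdfEmp n w' y ω

/-- The regression-adjusted estimator of the distributional treatment effect with known
adjustment terms `μ_w(y, ·, ·)` and `μ_{w'}(y, ·, ·)`. -/
def dteAdj (E : Experiment Ω K M d) (Q : Measure (UnitData K M d)) [IsFiniteMeasure Q]
    (w w' : Fin K) (y : ℝ) (n : ℕ) (ω : Ω) : ℝ :=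
  E.cdfAIPW (condCDF Q w y) n w y ω - E.cdfAIPW (condCDF Q w' y) n w' y ω

/-- Covariate-adaptive randomization with target assignment probabilities `π w s`, for units
whose characteristics have law `Q`. -/
structure IsCAR [MeasurableSpace Ω] (E : Experiment Ω K M d) (P : Measure Ω)
    (Q : Measure (UnitData K M d)) (π : Fin K → Fin M → ℝ) : Prop where
  measurable_unit : ∀ n i, Measurable (E.unit n i)
  measurable_treat : ∀ n i, Measurable (E.treat n i)
  /-- `p(s) > 0`: no stratum is empty in the population. -/
  strat_pos : ∀ s : Fin M, 0 < Q {u | u.2.1 = s}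
  target_mem : ∀ w s, π w s ∈ Set.Ioo (0 : ℝ) 1
  /-- The units of each sample are independent … -/
  indep : ∀ n, iIndepFun (E.unit n) P
  /-- … and identically distributed, with a law that does not depend on the sample size. -/
  law : ∀ n i, HasLaw (E.unit n i) Q P
  /-- Potential outcomes and covariates of the sample are independent of the assignments given
  the strata of the sample. The strata take finitely many values, so this is independence under
  the elementary conditional probability given each value (of positive probability). -/
  condIndep : ∀ (n : ℕ) (s : Fin n → Fin M),
    IndepFun (fun ω (i : Fin n) => ((fun w => E.pot n i w ω), E.cov n i ω))
      (fun ω (i : Fin n) => E.treat n i ω)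
      (P[|{ω | ∀ i, E.strat n i ω = s i}])
  /-- `π̂_w(s) → π_w(s)` in probability. -/
  tendsto_piHat : ∀ w s,
    TendstoInMeasure P (fun n => E.piHat n w s) atTop (fun _ => π w s)

end Experiment

/-- `V` is the asymptotic variance of the estimators `T n` of `θ`:
`√n (T n - θ)` converges in distribution to `N(0, V)`. -/
def HasAsymptoticVariance [MeasurableSpace Ω] (P : Measure Ω) [IsProbabilityMeasure P]
    (T : ℕ → Ω → ℝ) (θ : ℝ) (V : ℝ≥0) : Prop :=
  TendstoInDistribution (fun (n : ℕ) ω => Real.sqrt n * (T n ω - θ)) atTop (id : ℝ → ℝ)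
    (fun _ => P) (gaussianReal 0 V)

end

end CAR

/-! ### Asymptotics of powers of characteristic functions. -/

namespace CAR

/-! Both estimators are AIPW differences, the empirical one with adjustment terms zero, so a single
central limit theorem for bounded adjustment terms serves for both, and the variances are then
compared.

Reduction to centered sums: within a stratum the weights `1{W_i = w} / π̂_w(S_i)` add up to the
stratum size. Subtracting stratum means from the weighted terms therefore costs nothing, and once
every estimated propensity involved is nonzero the scaled error equals exactly `normalizedSum`:
scores with mean zero in each stratum, plus a function `ζ` of the stratum (`sqrt_mul_cdfAIPW_sub`).

Limit law: given all strata and assignments, the units are independent and each follows its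
within-stratum law (`integral_prod_eq_integral_prod_cond`). The conditional characteristic function
of the score part is thus a product over cells (treatment, stratum) of powers with exponents
`n_w(s)`. Along subsequences on which the empirical frequencies converge almost surely, it tends to
a deterministic Gaussian factor. The `ζ` part is an i.i.d. sum with its own Gaussian limit, and
because the first limit is deterministic the factors multiply
(`tendsto_integral_exp_normalizedSum`). No model of the assignment mechanism beyond consistency of
the frequencies is needed.

Variance: split each centered outcome indicator as `e + k`, with `e` the residual from the
conditional distribution function and `k` a function of stratum and covariates. By orthogonality
(`integral_mul_outcomeInd_sub_condCDF`), the two variances differ only in their `k` parts: the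
empirical score has a contrast that depends on the treatment received, the adjusted score has the
average of this contrast over treatments. Jensen's inequality for the square concludes
(`limitVariance_condCDF_le`). -/

lemma tendsto_pow_of_tendsto_mul_sub_one {z : ℕ → ℂ} {N k : ℕ → ℕ} {L : ℂ} {q : ℝ}
    (hN : Tendsto N atTop atTop)
    (hz : Tendsto (fun j => (N j : ℂ) * (z j - 1)) atTop (𝓝 L))
    (hk : Tendsto (fun j => (k j : ℝ) / N j) atTop (𝓝 q)) :
    Tendsto (fun j => z j ^ k j) atTop (𝓝 (Complex.exp (q * L))) := by
  have hNinv : Tendsto (fun j => ((N j : ℂ))⁻¹) atTop (𝓝 0) :=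
    (tendsto_inv_atTop_nhds_zero_nat (𝕜 := ℂ)).comp hN
  have hNne : ∀ᶠ j in atTop, (N j : ℂ) ≠ 0 := by
    filter_upwards [hN.eventually_ge_atTop 1] with j hj
    exact_mod_cast (by omega : N j ≠ 0)
  have hz0 : Tendsto (fun j => z j - 1) atTop (𝓝 0) := by
    have := hNinv.mul hz
    rw [zero_mul] at this
    refine this.congr' ?_
    filter_upwards [hNne] with j hj
    field_simp
  have hz1 : Tendsto z atTop (𝓝 1) := by simpa using hz0.add_const 1
  -- Since `log w` and `w - 1` agree to first order at `1`, `N log z` inherits the limit of `N (z -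
  -- 1)`; then `z ^ k = exp ((k / N) * (N log z))`.
  have hder : (fun w : ℂ => Complex.log w - (w - 1)) =o[𝓝 1] fun w => w - 1 := by
    have := (Complex.hasDerivAt_log (z := 1) (by simp)).isLittleO
    simpa using this
  have hlog : Tendsto (fun j => (N j : ℂ) * Complex.log (z j)) atTop (𝓝 L) := by
    have h1 : (fun j => (N j : ℂ) * (Complex.log (z j) - (z j - 1))) =o[atTop]
        fun j => (N j : ℂ) * (z j - 1) :=
      (Asymptotics.isBigO_refl _ _).mul_isLittleO (hder.comp_tendsto hz1)
    have h2 := (Asymptotics.isLittleO_one_iff ℂ).1 (h1.trans_isBigO (hz.isBigO_one ℂ))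
    have h3 := h2.add hz
    rw [zero_add] at h3
    exact h3.congr fun j => by ring
  have hk' : Tendsto (fun j => (k j : ℂ) / N j) atTop (𝓝 (q : ℂ)) := by
    have := (Complex.continuous_ofReal.tendsto q).comp hk
    simpa [Function.comp_def] using this
  have hmul := (Complex.continuous_exp.tendsto _).comp (hk'.mul hlog)
  refine hmul.congr' ?_
  filter_upwards [hNne, hz1.eventually_ne one_ne_zero] with j hj hzj
  have : (k j : ℂ) / N j * (N j * Complex.log (z j)) = k j * Complex.log (z j) := by
    field_simp
  simp only [Function.comp_apply, this]
  rw [Complex.exp_nat_mul, Complex.exp_log hzj]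

/-- For small `x` this is the Taylor remainder; for `|x| > 1` the triangle inequality gives `2 + |x|
≤ 3 * x ^ 2`. Being valid for all real `x`, it provides the dominating function for the second order
expansion. -/
lemma norm_exp_mul_I_sub_one_sub_le (x : ℝ) :
    ‖Complex.exp (x * Complex.I) - 1 - x * Complex.I‖ ≤ 3 * x ^ 2 := by
  have hn : ‖(x : ℂ) * Complex.I‖ = |x| := by simp
  rcases le_or_gt |x| 1 with h | h
  · have := Complex.norm_exp_sub_one_sub_id_le (x := x * Complex.I) (by rwa [hn])
    rw [hn, sq_abs] at this
    nlinarith [sq_nonneg x]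
  · have h1 : ‖Complex.exp (x * Complex.I) - 1 - x * Complex.I‖ ≤ 1 + 1 + |x| := by
      refine (norm_sub_le _ _).trans ?_
      rw [hn]
      gcongr
      refine (norm_sub_le _ _).trans ?_
      rw [Complex.norm_exp_ofReal_mul_I]
      simp
    nlinarith [sq_abs x]

/-- With `u = x / √N`, the quadratic term times `N` is exactly `-x ^ 2 / 2`, and the cubic remainder
times `N` is at most `x ^ 2 * |u|`, which vanishes. The point `x` varies with `j` because the scores
carry estimated propensities. -/
lemma tendsto_natCast_mul_exp_sub_one_sub {N : ℕ → ℕ} {x : ℕ → ℝ} {x₀ : ℝ}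
    (hN : Tendsto N atTop atTop) (hx : Tendsto x atTop (𝓝 x₀)) :
    Tendsto (fun j => (N j : ℂ) * (Complex.exp ((x j / √(N j) : ℝ) * Complex.I) - 1
      - (x j / √(N j) : ℝ) * Complex.I)) atTop (𝓝 ((-(x₀ ^ 2) / 2 : ℝ) : ℂ)) := by
  have hs : Tendsto (fun j => √(N j : ℝ)) atTop atTop :=
    Real.tendsto_sqrt_atTop.comp (tendsto_natCast_atTop_atTop.comp hN)
  have hy : Tendsto (fun j => x j / √(N j)) atTop (𝓝 0) := hx.div_atTop hs
  have hmain : Tendsto (fun j => ((-(x j ^ 2) / 2 : ℝ) : ℂ)) atTop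
      (𝓝 ((-(x₀ ^ 2) / 2 : ℝ) : ℂ)) :=
    (Complex.continuous_ofReal.tendsto _).comp (((hx.pow 2).neg).div_const 2)
  have herr : Tendsto (fun j => (N j : ℂ) * (Complex.exp ((x j / √(N j) : ℝ) * Complex.I) - 1
      - (x j / √(N j) : ℝ) * Complex.I) - ((-(x j ^ 2) / 2 : ℝ) : ℂ)) atTop (𝓝 0) := by
    have hb : Tendsto (fun j => x j ^ 2 * |x j / √(N j)|) atTop (𝓝 0) := by
      simpa using (hx.pow 2).mul hy.abs
    refine squeeze_zero_norm' ?_ hb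
    filter_upwards [hN.eventually_ge_atTop 1,
      hy.abs.eventually_le_const (by simp : |(0:ℝ)| < 1)] with j hj hle
    set u := x j / √(N j) with hu
    have hNpos : (0 : ℝ) < N j := by exact_mod_cast hj
    have hxu : x j ^ 2 = N j * u ^ 2 := by
      rw [hu, div_pow, Real.sq_sqrt hNpos.le]; field_simp
    have hnu : ‖(u : ℂ) * Complex.I‖ = |u| := by simp
    have hbd := Complex.exp_bound (x := u * Complex.I) (by rwa [hnu]) (n := 3) (by norm_num)
    rw [hnu] at hbd
    have heq : (N j : ℂ) * (Complex.exp (u * Complex.I) - 1 - u * Complex.I)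
        - ((-(x j ^ 2) / 2 : ℝ) : ℂ) = (N j : ℂ) * (Complex.exp (u * Complex.I)
          - ∑ m ∈ Finset.range 3, (u * Complex.I) ^ m / m.factorial) := by
      rw [hxu]
      simp [Finset.sum_range_succ, Nat.factorial, mul_pow]
      ring
    rw [heq, norm_mul, Complex.norm_natCast, hxu, mul_assoc]
    gcongr
    refine hbd.trans ?_
    rw [← sq_abs u]
    norm_num [Nat.factorial, -sq_abs]
    nlinarith [pow_nonneg (abs_nonneg u) 3, sq_abs u]
  simpa using herr.add hmain

/-- Second order expansion of the characteristic functions of a converging, uniformly bounded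
sequence of centered variables. -/
lemma tendsto_natCast_mul_integral_exp_sub_one {α : Type*} [MeasurableSpace α] (μ : Measure α)
    [IsProbabilityMeasure μ] {N : ℕ → ℕ} {a : ℕ → α → ℝ} {a₀ : α → ℝ} {C : ℝ}
    (hN : Tendsto N atTop atTop) (ha : ∀ j, Measurable (a j))
    (hb : ∀ᶠ j in atTop, ∀ u, |a j u| ≤ C) (hlim : ∀ u, Tendsto (fun j => a j u) atTop (𝓝 (a₀ u)))
    (hmean : ∀ j, ∫ u, a j u ∂μ = 0) (t : ℝ) :
    Tendsto (fun j => (N j : ℂ) *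
        (∫ u, Complex.exp ((t * a j u / √(N j) : ℝ) * Complex.I) ∂μ - 1)) atTop
      (𝓝 ((-(t ^ 2) / 2 * ∫ u, a₀ u ^ 2 ∂μ : ℝ) : ℂ)) := by
  have hdct : Tendsto (fun j => ∫ u, (N j : ℂ) * (Complex.exp ((t * a j u / √(N j) : ℝ) * Complex.I)
      - 1 - (t * a j u / √(N j) : ℝ) * Complex.I) ∂μ) atTop
      (𝓝 (∫ u, ((-((t * a₀ u) ^ 2) / 2 : ℝ) : ℂ) ∂μ)) := by
    refine tendsto_integral_filter_of_dominated_convergence (fun _ => 3 * (t ^ 2 * C ^ 2)) ?_ ?_ ?_ ?_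
    · refine Eventually.of_forall fun j => Measurable.aestronglyMeasurable ?_
      have := ha j
      fun_prop
    · filter_upwards [hb, hN.eventually_ge_atTop 1] with j hj hNj
      refine Eventually.of_forall fun u => ?_
      have hNpos : (0 : ℝ) < N j := by exact_mod_cast hNj
      rw [norm_mul, Complex.norm_natCast]
      calc (N j : ℝ) * _ ≤ N j * (3 * (t * a j u / √(N j)) ^ 2) := by
            gcongr; exact norm_exp_mul_I_sub_one_sub_le _
        _ = 3 * (t ^ 2 * a j u ^ 2) := by
            rw [div_pow, Real.sq_sqrt hNpos.le]; field_simp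
        _ ≤ _ := by
            gcongr 3 * (t ^ 2 * ?_)
            exact sq_le_sq.2 ((hj u).trans (le_abs_self C))
    · exact integrable_const _
    · exact Eventually.of_forall fun u =>
        tendsto_natCast_mul_exp_sub_one_sub hN ((hlim u).const_mul t)
  have hlimeq : (∫ u, ((-((t * a₀ u) ^ 2) / 2 : ℝ) : ℂ) ∂μ)
      = ((-(t ^ 2) / 2 * ∫ u, a₀ u ^ 2 ∂μ : ℝ) : ℂ) := by
    rw [integral_complex_ofReal, ← integral_const_mul]
    congr 2
    ext u
    ring
  rw [hlimeq] at hdct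
  refine hdct.congr' ?_
  filter_upwards [hb] with j hj
  have hint : Integrable (a j) μ :=
    Integrable.of_bound (ha j).aestronglyMeasurable C (Eventually.of_forall hj)
  have hint2 : Integrable (fun u => ((t * a j u / √(N j) : ℝ) : ℂ) * Complex.I) μ :=
    (((hint.const_mul t).div_const _).ofReal).mul_const _
  have hint1 : Integrable (fun u => Complex.exp ((t * a j u / √(N j) : ℝ) * Complex.I)) μ := by
    refine Integrable.of_bound (C := 1) ?_ (Eventually.of_forall fun u => ?_)
    · have := ha j
      exact Measurable.aestronglyMeasurable (by fun_prop)
    · rw [Complex.norm_exp_ofReal_mul_I]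
  rw [integral_const_mul, integral_sub (hint1.sub' (integrable_const _)) hint2,
    integral_sub hint1 (integrable_const _), integral_mul_const, integral_complex_ofReal,
    integral_div, integral_const_mul, hmean j]
  simp

lemma tendsto_prod_pow_exp {ι : Type*} [Fintype ι] {z : ι → ℕ → ℂ} {N : ℕ → ℕ} {k : ι → ℕ → ℕ}
    {L : ι → ℂ} {q : ι → ℝ} (hN : Tendsto N atTop atTop)
    (hz : ∀ i, Tendsto (fun j => (N j : ℂ) * (z i j - 1)) atTop (𝓝 (L i)))
    (hk : ∀ i, Tendsto (fun j => (k i j : ℝ) / N j) atTop (𝓝 (q i))) :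
    Tendsto (fun j => ∏ i, z i j ^ k i j) atTop (𝓝 (Complex.exp (∑ i, q i * L i))) := by
  rw [Complex.exp_sum]
  exact tendsto_finsetProd _ fun i _ => tendsto_pow_of_tendsto_mul_sub_one hN (hz i) (hk i)

end CAR

/-! ### Almost sure subsequences, stratum frequencies, and the conditional law of the sample. -/

namespace CAR

/-- Extract subsequences one index at a time; earlier convergences survive further extraction, so
finiteness of the index set suffices. -/
lemma exists_seq_forall_tendsto_ae {Ω ι : Type*} [MeasurableSpace Ω] {P : Measure Ω} [Finite ι]
    {f : ι → ℕ → Ω → ℝ} {g : ι → ℝ}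
    (h : ∀ j, TendstoInMeasure P (f j) atTop fun _ => g j) {ms : ℕ → ℕ}
    (hms : Tendsto ms atTop atTop) :
    ∃ ns : ℕ → ℕ, StrictMono ns ∧
      ∀ᵐ ω ∂P, ∀ j, Tendsto (fun k => f j (ms (ns k)) ω) atTop (𝓝 (g j)) := by
  classical
  have := Fintype.ofFinite ι
  suffices H : ∀ s : Finset ι, ∃ ns : ℕ → ℕ, StrictMono ns ∧
      ∀ᵐ ω ∂P, ∀ j ∈ s, Tendsto (fun k => f j (ms (ns k)) ω) atTop (𝓝 (g j)) by
    simpa using H Finset.univ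
  intro s
  induction s using Finset.induction_on with
  | empty => exact ⟨id, strictMono_id, by simp⟩
  | insert a s _ ih =>
    obtain ⟨ns, hns, hae⟩ := ih
    have h1 : TendstoInMeasure P (fun k => f a (ms (ns k))) atTop fun _ => g a :=
      fun ε hε => (h a ε hε).comp (hms.comp hns.tendsto_atTop)
    obtain ⟨ks, hks, hae'⟩ := h1.exists_seq_tendsto_ae
    refine ⟨ns ∘ ks, hns.comp hks, ?_⟩
    filter_upwards [hae, hae'] with ω h2 h3 j hj
    rcases Finset.mem_insert.1 hj with rfl | hj
    · exact h3
    · exact (h2 j hj).comp hks.tendsto_atTop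

/-- Dominated convergence along subsequences: if finitely many `f j n` converge in measure to
constants, and `F n ω → 0` along every subsequence along which all `f j n ω` converge, then the
integrals of the uniformly bounded `F n` tend to `0`. -/
lemma tendsto_integral_zero_of_tendstoInMeasure {Ω ι : Type*} [MeasurableSpace Ω] {P : Measure Ω}
    [IsFiniteMeasure P] [Finite ι] {f : ι → ℕ → Ω → ℝ} {g : ι → ℝ}
    (h : ∀ j, TendstoInMeasure P (f j) atTop fun _ => g j)
    {F : ℕ → Ω → ℂ} {C : ℝ} (hF : ∀ n, AEStronglyMeasurable (F n) P) (hC : ∀ n ω, ‖F n ω‖ ≤ C)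
    (hlim : ∀ ω, ∀ ns : ℕ → ℕ, Tendsto ns atTop atTop →
      (∀ j, Tendsto (fun k => f j (ns k) ω) atTop (𝓝 (g j))) →
      Tendsto (fun k => F (ns k) ω) atTop (𝓝 0)) :
    Tendsto (fun n => ∫ ω, F n ω ∂P) atTop (𝓝 0) := by
  refine tendsto_of_subseq_tendsto fun ms hms => ?_
  obtain ⟨ns, hns, hae⟩ := exists_seq_forall_tendsto_ae h hms
  refine ⟨ns, ?_⟩
  have : (0 : ℂ) = ∫ _, (0 : ℂ) ∂P := by simp
  rw [this]
  refine tendsto_integral_of_dominated_convergence (fun _ => C) (fun n => hF _)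
    (integrable_const _) (fun n => Eventually.of_forall (hC _)) ?_
  filter_upwards [hae] with ω hω
  exact hlim ω (fun k => ms (ns k)) (hms.comp hns.tendsto_atTop) hω

variable {Ω : Type*} [MeasurableSpace Ω] {P : Measure Ω} {K M d : ℕ}
  {E : Experiment Ω K M d} {Q : Measure (UnitData K M d)}
  {π : Fin K → Fin M → ℝ}

lemma measurableSet_stratum (s : Fin M) : MeasurableSet {u : UnitData K M d | u.2.1 = s} :=
  (measurable_fst.comp measurable_snd) (measurableSet_singleton s)

namespace Experiment.IsCAR

lemma measurable_strat (hE : E.IsCAR P Q π) (n : ℕ) (i : Fin n) : Measurable (E.strat n i) :=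
  (measurable_fst.comp measurable_snd).comp (hE.measurable_unit n i)

lemma measurable_cov (hE : E.IsCAR P Q π) (n : ℕ) (i : Fin n) : Measurable (E.cov n i) :=
  (measurable_snd.comp measurable_snd).comp (hE.measurable_unit n i)

lemma measurable_pot (hE : E.IsCAR P Q π) (n : ℕ) (i : Fin n) :
    Measurable fun ω w => E.pot n i w ω :=
  measurable_fst.comp (hE.measurable_unit n i)

/-- Weak law of large numbers for the stratum sizes. -/
lemma tendsto_nStrat_div [IsProbabilityMeasure P] (hE : E.IsCAR P Q π) (s : Fin M) :
    TendstoInMeasure P (fun n ω => (E.nStrat n s ω : ℝ) / n) atTop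
      fun _ => Q.real {u | u.2.1 = s} := by
  set p := Q.real {u : UnitData K M d | u.2.1 = s} with hp
  let ind : UnitData K M d → ℝ := Set.indicator {u | u.2.1 = s} fun _ => 1
  have hind : Measurable ind := measurable_const.indicator (measurableSet_stratum s)
  have hbd : ∀ u, ind u ∈ Set.Icc (0 : ℝ) 1 := fun u => by
    simp only [ind, Set.indicator_apply]
    split_ifs <;> simp
  have hL : ∀ n i, MemLp (fun ω => ind (E.unit n i ω)) 2 P := fun n i =>
    MemLp.of_bound (hind.comp (hE.measurable_unit n i)).aestronglyMeasurable 1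
      (Eventually.of_forall fun ω => by
        rw [Real.norm_eq_abs, abs_le]
        have := hbd (E.unit n i ω)
        constructor <;> linarith [this.1, this.2])
  have hmean : ∀ n i, ∫ ω, ind (E.unit n i ω) ∂P = p := fun n i => by
    refine ((hE.law n i).integral_comp (f := ind) hind.aestronglyMeasurable).trans ?_
    simp only [ind]
    rw [integral_indicator_const _ (measurableSet_stratum s)]
    simp [hp]
  have hcount : ∀ n ω, (E.nStrat n s ω : ℝ) = (∑ i : Fin n, fun ω => ind (E.unit n i ω)) ω := by
    intro n ω
    simp [Experiment.nStrat, ind, Set.indicator_apply, Experiment.unit]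
  -- A crude bound is enough for Chebyshev: each indicator has variance at most `1 / 4`, hence at
  -- most `1`.
  have hvar : ∀ n, variance (∑ i : Fin n, fun ω => ind (E.unit n i ω)) P ≤ n := by
    intro n
    rw [IndepFun.variance_sum (fun i _ => hL n i)
      (fun i _ j _ hij => ((hE.indep n).indepFun hij).comp hind hind)]
    calc _ ≤ ∑ i : Fin n, (1 : ℝ) := Finset.sum_le_sum fun i _ => ?_
      _ = n := by simp
    refine (variance_le_sq_of_bounded (a := 0) (b := 1)
      (Eventually.of_forall fun ω => hbd _) (hL n i).aemeasurable).trans (by norm_num)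
  rw [tendstoInMeasure_iff_dist]
  intro ε hε
  have hzero : Tendsto (fun n : ℕ => ENNReal.ofReal (ε ^ 2)⁻¹ * (n : ℝ≥0∞)⁻¹) atTop (𝓝 0) := by
    have := ENNReal.Tendsto.const_mul (a := ENNReal.ofReal (ε ^ 2)⁻¹)
      ENNReal.tendsto_inv_nat_nhds_zero (Or.inr ENNReal.ofReal_ne_top)
    simpa using this
  refine tendsto_of_tendsto_of_tendsto_of_le_of_le' tendsto_const_nhds hzero
    (Eventually.of_forall fun _ => zero_le) ?_
  filter_upwards [eventually_ge_atTop 1] with n hn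
  have hnpos : (0 : ℝ) < n := by exact_mod_cast hn
  have hsum : MemLp (∑ i : Fin n, fun ω => ind (E.unit n i ω)) 2 P :=
    memLp_finsetSum' _ fun i _ => hL n i
  have hexp : P[∑ i : Fin n, fun ω => ind (E.unit n i ω)] = n * p := by
    simp only [Finset.sum_apply]
    rw [integral_finsetSum _ fun i _ => (hL n i).integrable (by norm_num)]
    simp [hmean]
  have hcheb := meas_ge_le_variance_div_sq hsum (c := n * ε) (by positivity)
  rw [hexp] at hcheb
  calc P {x | ε ≤ dist ((E.nStrat n s x : ℝ) / n) p}
      ≤ P {ω | n * ε ≤ |(∑ i : Fin n, fun ω => ind (E.unit n i ω)) ω - n * p|} := by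
        refine measure_mono fun ω hω => ?_
        simp only [Set.mem_ofPred_eq, hcount, Real.dist_eq] at hω ⊢
        have : (∑ i : Fin n, fun ω => ind (E.unit n i ω)) ω - n * p
            = n * ((∑ i : Fin n, fun ω => ind (E.unit n i ω)) ω / n - p) := by field_simp
        rw [this, abs_mul, abs_of_pos hnpos]
        gcongr
    _ ≤ _ := hcheb
    _ ≤ ENNReal.ofReal ((ε ^ 2)⁻¹ * (n : ℝ)⁻¹) := by
        apply ENNReal.ofReal_le_ofReal
        rw [div_le_iff₀ (by positivity)]
        refine (hvar n).trans (le_of_eq ?_)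
        field_simp
    _ = _ := by
        rw [ENNReal.ofReal_mul (by positivity), ENNReal.ofReal_inv_of_pos hnpos,
          ENNReal.ofReal_natCast]

/-- The factorisation of the law of the sample given the strata and the assignments. -/
lemma integral_indicator_prod [IsProbabilityMeasure Q] (hE : E.IsCAR P Q π) (n : ℕ) (sv : Fin n → Fin M)
    (wv : Fin n → Fin K) (f : Fin n → UnitData K M d → ℂ) (hf : ∀ i, Measurable (f i)) :
    ∫ ω in {ω | (∀ i, E.strat n i ω = sv i) ∧ ∀ i, E.treat n i ω = wv i},
        ∏ i, f i (E.unit n i ω) ∂P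
      = P.real {ω | (∀ i, E.strat n i ω = sv i) ∧ ∀ i, E.treat n i ω = wv i}
        * ∏ i, ∫ u, f i u ∂(Q[|{u | u.2.1 = sv i}]) := by
  classical
  set A := {ω | ∀ i, E.strat n i ω = sv i} with hA
  set B := {ω | ∀ i, E.treat n i ω = wv i} with hB
  have hAm : MeasurableSet A := by
    simp only [hA, Set.ofPred_forall]
    exact MeasurableSet.iInter fun i => hE.measurable_strat n i (measurableSet_singleton _)
  have hBm : MeasurableSet B := by
    simp only [hB, Set.ofPred_forall]
    exact MeasurableSet.iInter fun i => hE.measurable_treat n i (measurableSet_singleton _)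
  have hAB : {ω | (∀ i, E.strat n i ω = sv i) ∧ ∀ i, E.treat n i ω = wv i} = A ∩ B := rfl
  rw [hAB]
  have hprod : ∀ φ : Fin n → UnitData K M d → ℂ, (∀ i, Measurable (φ i)) →
      ∫ ω in A, ∏ i, φ i (E.unit n i ω) ∂P = ∏ i, ∫ u in {u | u.2.1 = sv i}, φ i u ∂Q := by
    intro φ hφ
    have hm : ∀ i, Measurable (Set.indicator {u | u.2.1 = sv i} (φ i)) := fun i =>
      (hφ i).indicator (measurableSet_stratum _)
    have h1 := (hE.indep n).integral_fun_prod_comp (f := fun i =>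
      Set.indicator {u | u.2.1 = sv i} (φ i)) (fun i => (hE.measurable_unit n i).aemeasurable)
      (fun i => (hm i).aestronglyMeasurable)
    rw [← integral_indicator hAm]
    calc _ = ∫ ω, ∏ i, Set.indicator {u | u.2.1 = sv i} (φ i) (E.unit n i ω) ∂P := by
          congr 1
          ext ω
          by_cases h : ω ∈ A
          · rw [Set.indicator_of_mem h]
            refine Finset.prod_congr rfl fun i _ => ?_
            rw [Set.indicator_of_mem]
            exact h i
          · rw [Set.indicator_of_notMem h]
            simp only [hA, Set.mem_ofPred_eq, not_forall] at h
            obtain ⟨i, hi⟩ := h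
            refine (Finset.prod_eq_zero (Finset.mem_univ i) ?_).symm
            rw [Set.indicator_of_notMem]
            exact hi
      _ = _ := h1
      _ = _ := by
          refine Finset.prod_congr rfl fun i _ => ?_
          refine ((hE.law n i).integral_comp (f := Set.indicator {u | u.2.1 = sv i} (φ i))
            (hm i).aestronglyMeasurable).trans ?_
          rw [integral_indicator (measurableSet_stratum _)]
  have hcondQ : ∀ i, ∫ u, f i u ∂(Q[|{u | u.2.1 = sv i}])
      = ((Q.real {u | u.2.1 = sv i})⁻¹ : ℝ) * ∫ u in {u | u.2.1 = sv i}, f i u ∂Q := by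
    intro i
    rw [ProbabilityTheory.cond, integral_smul_measure, ENNReal.toReal_inv, Complex.real_smul]
    rfl
  have hPA : (P.real A : ℂ) = ∏ i, (Q.real {u : UnitData K M d | u.2.1 = sv i} : ℂ) := by
    have := hprod (fun _ _ => 1) (fun _ => measurable_const)
    simpa using this
  -- Positive stratum probabilities give every stratum vector positive probability, so conditioning
  -- on `A` is nondegenerate and the factor `P.real A` can be cancelled below.
  have hQne : ∀ s : Fin M, (Q.real {u : UnitData K M d | u.2.1 = s} : ℂ) ≠ 0 := fun s => by
    have := ENNReal.toReal_pos (hE.strat_pos s).ne' (measure_ne_top _ _)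
    exact_mod_cast this.ne'
  have hPAne : (P.real A : ℂ) ≠ 0 := by
    rw [hPA]; exact Finset.prod_ne_zero_iff.2 fun i _ => hQne _
  have hcondP : ∀ G : Ω → ℂ, ∫ ω, G ω ∂(P[|A]) = (P.real A : ℂ)⁻¹ * ∫ ω in A, G ω ∂P := by
    intro G
    rw [ProbabilityTheory.cond, integral_smul_measure, ENNReal.toReal_inv, Complex.real_smul]
    simp [Measure.real]
  -- on `A`, the units are functions of potential outcomes and covariates
  let Φ : (Fin n → (Fin K → ℝ) × (Fin d → ℝ)) → ℂ := fun x => ∏ i, f i ((x i).1, sv i, (x i).2)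
  let Ψ : (Fin n → Fin K) → ℂ := fun v => if v = wv then 1 else 0
  have hΦ : Measurable Φ := by
    refine Finset.measurable_fun_prod _ fun i _ => (hf i).comp ?_
    fun_prop
  have hΨ : Measurable Ψ := measurable_of_finite _
  have hX : Measurable fun ω (i : Fin n) => ((fun w => E.pot n i w ω), E.cov n i ω) :=
    measurable_pi_lambda _ fun i => (hE.measurable_pot n i).prodMk (hE.measurable_cov n i)
  have hW : Measurable fun ω (i : Fin n) => E.treat n i ω :=
    measurable_pi_lambda _ fun i => hE.measurable_treat n i
  have hind := ((hE.condIndep n sv).comp hΦ hΨ).integral_fun_mul_eq_mul_integral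
    (hΦ.comp hX).aestronglyMeasurable (hΨ.comp hW).aestronglyMeasurable
  rw [hcondP, hcondP, hcondP] at hind
  have hΨB : ∀ ω, Ψ (fun i => E.treat n i ω) = Set.indicator B (fun _ => (1 : ℂ)) ω := by
    intro ω
    simp only [Ψ, Set.indicator_apply, hB, Set.mem_ofPred_eq, funext_iff]
  have hΦA : ∀ ω ∈ A, Φ (fun i => ((fun w => E.pot n i w ω), E.cov n i ω))
      = ∏ i, f i (E.unit n i ω) := by
    intro ω hω
    refine Finset.prod_congr rfl fun i _ => ?_
    rw [Experiment.unit, hω i]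
  have e1 : ∫ ω in A, (Φ ∘ fun ω (i : Fin n) => ((fun w => E.pot n i w ω), E.cov n i ω)) ω *
        (Ψ ∘ fun ω (i : Fin n) => E.treat n i ω) ω ∂P
      = ∫ ω in A ∩ B, ∏ i, f i (E.unit n i ω) ∂P := by
    rw [← setIntegral_indicator hBm]
    refine setIntegral_congr_fun hAm fun ω hω => ?_
    simp only [Function.comp_apply, hΨB, hΦA ω hω, Set.indicator_apply]
    split_ifs <;> simp
  have e2 : ∫ ω in A, (Φ ∘ fun ω (i : Fin n) => ((fun w => E.pot n i w ω), E.cov n i ω)) ω ∂P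
      = ∏ i, ∫ u in {u | u.2.1 = sv i}, f i u ∂Q := by
    rw [← hprod f hf]
    exact setIntegral_congr_fun hAm fun ω hω => hΦA ω hω
  have e3 : ∫ ω in A, (Ψ ∘ fun ω (i : Fin n) => E.treat n i ω) ω ∂P = P.real (A ∩ B) := by
    simp only [Function.comp_apply, hΨB]
    rw [setIntegral_indicator hBm]
    simp
  rw [e1, e2, e3] at hind
  simp_rw [hcondQ]
  rw [Finset.prod_mul_distrib]
  push_cast
  rw [Finset.prod_inv_distrib, ← hPA]
  have := congrArg (fun z => (P.real A : ℂ) * z) hind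
  simp only [mul_inv_cancel_left₀ hPAne] at this
  rw [this]
  field_simp

/-- Given the strata and the assignments, the units of the sample are independent, and unit `i` has
the conditional law given its stratum. -/
lemma integral_prod_eq_integral_prod_cond [IsProbabilityMeasure P] [IsProbabilityMeasure Q]
    (hE : E.IsCAR P Q π) (n : ℕ)
    (f : (Fin n → Fin M) → (Fin n → Fin K) → Fin n → UnitData K M d → ℂ)
    (hf : ∀ sv wv i, Measurable (f sv wv i)) (hf1 : ∀ sv wv i u, ‖f sv wv i u‖ ≤ 1) :
    ∫ ω, ∏ i, f (fun j => E.strat n j ω) (fun j => E.treat n j ω) i (E.unit n i ω) ∂P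
      = ∫ ω, ∏ i, (∫ u, f (fun j => E.strat n j ω) (fun j => E.treat n j ω) i u
          ∂(Q[|{u | u.2.1 = E.strat n i ω}])) ∂P := by
  classical
  -- The values of the strata and treatment vectors partition `Ω` into finitely many events. On each
  -- of them the integrand is a product of fixed functions of single units, so the factorisation
  -- applies.
  let T : (Fin n → Fin M) × (Fin n → Fin K) → Set Ω := fun c =>
    {ω | (∀ i, E.strat n i ω = c.1 i) ∧ ∀ i, E.treat n i ω = c.2 i}
  have hT : ∀ c, MeasurableSet (T c) := fun c => by
    simp only [T, Set.ofPred_and, Set.ofPred_forall]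
    exact (MeasurableSet.iInter fun i => hE.measurable_strat n i (measurableSet_singleton _)).inter
      (MeasurableSet.iInter fun i => hE.measurable_treat n i (measurableSet_singleton _))
  have hdisj : Pairwise (Function.onFun Disjoint T) := by
    intro c c' hcc
    refine Set.disjoint_left.2 fun ω h h' => hcc ?_
    ext i
    · rw [← h.1 i, h'.1 i]
    · rw [← h.2 i, h'.2 i]
  have huniv : ⋃ c, T c = Set.univ := by
    refine Set.eq_univ_of_forall fun ω => Set.mem_iUnion.2 ⟨(fun j => E.strat n j ω,
      fun j => E.treat n j ω), fun _ => rfl, fun _ => rfl⟩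
  have hsplit : ∀ G : Ω → ℂ, (∀ c, IntegrableOn G (T c) P) →
      ∫ ω, G ω ∂P = ∑ c, ∫ ω in T c, G ω ∂P := by
    intro G hG
    rw [← setIntegral_univ, ← huniv, integral_iUnion_fintype hT hdisj hG]
  have hL : ∀ c, Set.EqOn
      (fun ω => ∏ i, f (fun j => E.strat n j ω) (fun j => E.treat n j ω) i (E.unit n i ω))
      (fun ω => ∏ i, f c.1 c.2 i (E.unit n i ω)) (T c) := by
    intro c ω hω
    have h1 : (fun j => E.strat n j ω) = c.1 := funext hω.1
    have h2 : (fun j => E.treat n j ω) = c.2 := funext hω.2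
    simp only [h1, h2]
  have hR : ∀ c, Set.EqOn (fun ω => ∏ i, (∫ u, f (fun j => E.strat n j ω) (fun j => E.treat n j ω)
        i u ∂(Q[|{u | u.2.1 = E.strat n i ω}])))
      (fun _ => ∏ i, ∫ u, f c.1 c.2 i u ∂(Q[|{u | u.2.1 = c.1 i}])) (T c) := by
    intro c ω hω
    have h2 : (fun j => E.treat n j ω) = c.2 := funext hω.2
    simp only [h2, hω.1]
  rw [hsplit, hsplit]
  · refine Finset.sum_congr rfl fun c _ => ?_
    rw [setIntegral_congr_fun (hT c) (hL c), setIntegral_congr_fun (hT c) (hR c),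
      hE.integral_indicator_prod n c.1 c.2 _ (hf c.1 c.2), setIntegral_const, Complex.real_smul]
  · intro c
    exact (integrableOn_congr_fun (hR c) (hT c)).2 (integrable_const _)
  · intro c
    refine (integrableOn_congr_fun (hL c) (hT c)).2 (Integrable.of_bound (C := 1) ?_ ?_)
    · exact (Finset.measurable_fun_prod _ fun i _ =>
        (hf c.1 c.2 i).comp (hE.measurable_unit n i)).aestronglyMeasurable
    · refine Eventually.of_forall fun ω => ?_
      rw [norm_prod]
      exact Finset.prod_le_one (fun _ _ => norm_nonneg _) fun i _ => hf1 _ _ _ _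

end Experiment.IsCAR

end CAR

/-! ### Central limit theorem for the normalized sum of scores. -/

namespace CAR

noncomputable section

/-- The influence function of a unit in stratum `s` with treatment `v`, for the contrast of the
treatments `w` and `w'`, with inverse propensity weights built from `c`. -/
def score {K M d : ℕ} (w w' : Fin K) (h₁ h₂ g : UnitData K M d → ℝ) (c : Fin K → Fin M → ℝ)
    (v : Fin K) (s : Fin M) (u : UnitData K M d) : ℝ :=
  (if v = w then (c w s)⁻¹ else 0) * h₁ u - (if v = w' then (c w' s)⁻¹ else 0) * h₂ u + g u

/-- The normalized sum of the influence functions with estimated propensities, plus a function `ζ`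
of the strata. -/
def normalizedSum {Ω : Type*} {K M d : ℕ} (E : Experiment Ω K M d) (w w' : Fin K)
    (h₁ h₂ g : UnitData K M d → ℝ) (ζ : Fin M → ℝ) (n : ℕ) (ω : Ω) : ℝ :=
  (√n)⁻¹ * ∑ i : Fin n, (score w w' h₁ h₂ g (fun v s => E.piHat n v s ω) (E.treat n i ω)
    (E.strat n i ω) (E.unit n i ω) + ζ (E.strat n i ω))

/-- The limiting variance of `normalizedSum`. -/
def limitVariance {K M d : ℕ} (Q : Measure (UnitData K M d)) (π : Fin K → Fin M → ℝ) (w w' : Fin K)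
    (h₁ h₂ g : UnitData K M d → ℝ) (ζ : Fin M → ℝ) : ℝ :=
  (∑ s, ∑ v, π v s * ∫ u in {u | u.2.1 = s}, score w w' h₁ h₂ g π v s u ^ 2 ∂Q)
    + ∫ u, ζ u.2.1 ^ 2 ∂Q

/-- `n_w(s) / n(s)` as a function of the vectors of strata and of treatments. -/
def treatFreq {K M n : ℕ} (sv : Fin n → Fin M) (wv : Fin n → Fin K) (w : Fin K) (s : Fin M) : ℝ :=
  ((Finset.univ.filter fun i => wv i = w ∧ sv i = s).card : ℝ) /
    ((Finset.univ.filter fun i => sv i = s).card : ℝ)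

variable {Ω : Type*} {K M d : ℕ}

lemma piHat_eq_treatFreq (E : Experiment Ω K M d) (n : ℕ) (w : Fin K) (s : Fin M) (ω : Ω) :
    E.piHat n w s ω
      = treatFreq (fun i : Fin n => E.strat n i ω) (fun i : Fin n => E.treat n i ω) w s :=
  rfl

/-- Expresses cell frequencies through the two quantities known to converge. On an empty stratum
both sides are `0`, as the cell is then empty too. -/
lemma nTreat_div_eq (E : Experiment Ω K M d) (n : ℕ) (w : Fin K) (s : Fin M) (ω : Ω) :
    (E.nTreat n w s ω : ℝ) / n = E.piHat n w s ω * ((E.nStrat n s ω : ℝ) / n) := by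
  have hle : E.nTreat n w s ω ≤ E.nStrat n s ω :=
    Finset.card_le_card fun i hi => by
      simp only [Finset.mem_filter] at hi ⊢
      exact ⟨hi.1, hi.2.2⟩
  unfold Experiment.piHat
  by_cases h : E.nStrat n s ω = 0
  · simp [h, Nat.le_zero.1 (h ▸ hle)]
  · have : (E.nStrat n s ω : ℝ) ≠ 0 := by exact_mod_cast h
    field_simp

variable [MeasurableSpace Ω] {P : Measure Ω}
  {E : Experiment Ω K M d} {Q : Measure (UnitData K M d)} {π : Fin K → Fin M → ℝ}

lemma measurable_score {w w' : Fin K} {h₁ h₂ g : UnitData K M d → ℝ} (hh₁ : Measurable h₁)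
    (hh₂ : Measurable h₂) (hg : Measurable g) (c : Fin K → Fin M → ℝ) (v : Fin K) (s : Fin M) :
    Measurable (score w w' h₁ h₂ g c v s) :=
  ((hh₁.const_mul _).sub (hh₂.const_mul _)).add hg

lemma integral_cond_stratum [IsFiniteMeasure Q] {F : Type*} [NormedAddCommGroup F] [NormedSpace ℝ F]
    {s : Fin M} (hs : 0 < Q {u | u.2.1 = s}) (f : UnitData K M d → F) :
    Q.real {u | u.2.1 = s} • ∫ u, f u ∂(Q[|{u | u.2.1 = s}]) = ∫ u in {u | u.2.1 = s}, f u ∂Q := by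
  have := ENNReal.toReal_pos hs.ne' (measure_ne_top _ _)
  rw [ProbabilityTheory.cond, integral_smul_measure, ENNReal.toReal_inv, smul_smul, Measure.real,
    mul_inv_cancel₀ this.ne', one_smul]

lemma integral_eq_sum_stratum {F : Type*} [NormedAddCommGroup F] [NormedSpace ℝ F]
    {f : UnitData K M d → F} (hf : Integrable f Q) :
    ∫ u, f u ∂Q = ∑ s, ∫ u in {u | u.2.1 = s}, f u ∂Q := by
  have huniv : ⋃ s : Fin M, {u : UnitData K M d | u.2.1 = s} = Set.univ :=
    Set.eq_univ_of_forall fun u => Set.mem_iUnion.2 ⟨u.2.1, rfl⟩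
  rw [← setIntegral_univ, ← huniv, integral_iUnion_fintype measurableSet_stratum _
    fun s => hf.integrableOn]
  intro s s' hs
  exact Set.disjoint_left.2 fun u h h' => hs (h.symm.trans h')

namespace Experiment.IsCAR

lemma isProbabilityMeasure_cond (hE : E.IsCAR P Q π) [IsFiniteMeasure Q] (s : Fin M) :
    IsProbabilityMeasure (Q[|{u | u.2.1 = s}]) :=
  cond_isProbabilityMeasure (hE.strat_pos s).ne'

lemma measurable_of_vectors (hE : E.IsCAR P Q π) {β : Type*} [MeasurableSpace β] (n : ℕ)
    (G : (Fin n → Fin M) × (Fin n → Fin K) → β) :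
    Measurable fun ω => G (fun i => E.strat n i ω, fun i => E.treat n i ω) :=
  (measurable_of_finite G).comp ((measurable_pi_lambda _ fun i => hE.measurable_strat n i).prodMk
    (measurable_pi_lambda _ fun i => hE.measurable_treat n i))

/-- The targets are positive, so the inverse weights converge and are eventually bounded. The score
is then a uniformly bounded convergent sequence, centered for every choice of weights, as the second
order expansion demands. -/
lemma tendsto_natCast_mul_integral_score (hE : E.IsCAR P Q π) [IsProbabilityMeasure Q]
    {w w' : Fin K} {h₁ h₂ g : UnitData K M d → ℝ} (hh₁ : Measurable h₁) (hh₂ : Measurable h₂)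
    (hg : Measurable g) {C : ℝ} (hb₁ : ∀ u, |h₁ u| ≤ C) (hb₂ : ∀ u, |h₂ u| ≤ C)
    (hbg : ∀ u, |g u| ≤ C) (hm₁ : ∀ s, ∫ u, h₁ u ∂(Q[|{u | u.2.1 = s}]) = 0)
    (hm₂ : ∀ s, ∫ u, h₂ u ∂(Q[|{u | u.2.1 = s}]) = 0)
    (hmg : ∀ s, ∫ u, g u ∂(Q[|{u | u.2.1 = s}]) = 0)
    {N : ℕ → ℕ} (hN : Tendsto N atTop atTop) {c : ℕ → Fin K → Fin M → ℝ}
    (hc : ∀ v s, Tendsto (fun j => c j v s) atTop (𝓝 (π v s))) (t : ℝ) (v : Fin K) (s : Fin M) :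
    Tendsto (fun j => (N j : ℂ) * (∫ u, Complex.exp ((t * score w w' h₁ h₂ g (c j) v s u / √(N j) : ℝ)
        * Complex.I) ∂(Q[|{u | u.2.1 = s}]) - 1)) atTop
      (𝓝 ((-(t ^ 2) / 2 * ∫ u, score w w' h₁ h₂ g π v s u ^ 2 ∂(Q[|{u | u.2.1 = s}]) : ℝ) : ℂ)) := by
  have := hE.isProbabilityMeasure_cond s
  have hα : ∀ x : Fin K, Tendsto (fun j => if v = x then (c j x s)⁻¹ else 0) atTop
      (𝓝 (if v = x then (π x s)⁻¹ else 0)) := by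
    intro x
    split_ifs
    · exact (hc x s).inv₀ (hE.target_mem x s).1.ne'
    · exact tendsto_const_nhds
  have hαb : ∀ x : Fin K, ∀ᶠ j in atTop, |if v = x then (c j x s)⁻¹ else 0|
      ≤ |if v = x then (π x s)⁻¹ else 0| + 1 := fun x =>
    (hα x).abs.eventually_le_const (lt_add_one _)
  have hi : ∀ f : UnitData K M d → ℝ, Measurable f → (∀ u, |f u| ≤ C) →
      Integrable f (Q[|{u | u.2.1 = s}]) := fun f hf hfb =>
    Integrable.of_bound hf.aestronglyMeasurable C (Eventually.of_forall hfb)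
  refine tendsto_natCast_mul_integral_exp_sub_one _
    (C := (|if v = w then (π w s)⁻¹ else 0| + 1) * C + (|if v = w' then (π w' s)⁻¹ else 0| + 1) * C
      + C) hN (fun j => measurable_score hh₁ hh₂ hg _ _ _) ?_ ?_ ?_ t
  · filter_upwards [hαb w, hαb w'] with j h1 h2 u
    unfold score
    refine (abs_add_le _ _).trans (add_le_add ((abs_sub _ _).trans (add_le_add ?_ ?_)) (hbg u))
    · rw [abs_mul]
      exact mul_le_mul h1 (hb₁ u) (abs_nonneg _) (by positivity)
    · rw [abs_mul]
      exact mul_le_mul h2 (hb₂ u) (abs_nonneg _) (by positivity)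
  · intro u
    exact (((hα w).mul_const _).sub ((hα w').mul_const _)).add_const _
  · intro j
    unfold score
    rw [integral_add (((hi _ hh₁ hb₁).const_mul _).sub' ((hi _ hh₂ hb₂).const_mul _)) (hi _ hg hbg),
      integral_sub ((hi _ hh₁ hb₁).const_mul _) ((hi _ hh₂ hb₂).const_mul _), integral_const_mul,
      integral_const_mul, hm₁, hm₂, hmg]
    simp

variable [IsProbabilityMeasure P]

/-- Integrals of bounded functions vanish in the limit if the functions do so along all
subsequences along which the assignment frequencies and the stratum frequencies converge. -/
lemma tendsto_integral_zero (hE : E.IsCAR P Q π) {F : ℕ → Ω → ℂ} {C : ℝ}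
    (hF : ∀ n, AEStronglyMeasurable (F n) P) (hC : ∀ n ω, ‖F n ω‖ ≤ C)
    (hlim : ∀ ω, ∀ ns : ℕ → ℕ, Tendsto ns atTop atTop →
      (∀ v s, Tendsto (fun k => E.piHat (ns k) v s ω) atTop (𝓝 (π v s))) →
      (∀ s, Tendsto (fun k => (E.nStrat (ns k) s ω : ℝ) / (ns k : ℕ)) atTop
        (𝓝 (Q.real {u | u.2.1 = s}))) →
      Tendsto (fun k => F (ns k) ω) atTop (𝓝 0)) :
    Tendsto (fun n => ∫ ω, F n ω ∂P) atTop (𝓝 0) := by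
  refine tendsto_integral_zero_of_tendstoInMeasure (ι := (Fin K × Fin M) ⊕ Fin M)
    (f := Sum.elim (fun c n ω => E.piHat n c.1 c.2 ω) fun s n ω => (E.nStrat n s ω : ℝ) / n)
    (g := Sum.elim (fun c => π c.1 c.2) fun s => Q.real {u | u.2.1 = s}) ?_ hF hC ?_
  · rintro (c | s)
    · exact hE.tendsto_piHat c.1 c.2
    · exact hE.tendsto_nStrat_div s
  · intro ω ns hns h
    exact hlim ω ns hns (fun v s => h (Sum.inl (v, s))) fun s => h (Sum.inr s)

variable [IsProbabilityMeasure Q]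

/-- Not part of `IsCAR`: it is inherited from the empirical frequencies, which sum to `1` as soon as
the stratum is nonempty. It is what makes the targets usable as Jensen weights. -/
lemma sum_target_eq_one (hE : E.IsCAR P Q π) (s : Fin M) : ∑ v, π v s = 1 := by
  obtain ⟨ns, hns, hae⟩ := exists_seq_forall_tendsto_ae (ι := Option (Fin K))
    (f := fun o n ω => o.elim ((E.nStrat n s ω : ℝ) / n) fun v => E.piHat n v s ω)
    (g := fun o => o.elim (Q.real {u | u.2.1 = s}) fun v => π v s) (P := P)
    (by rintro (_ | v)
        · exact hE.tendsto_nStrat_div s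
        · exact hE.tendsto_piHat v s) tendsto_id
  obtain ⟨ω, hω⟩ := hae.exists
  have hp : 0 < Q.real {u : UnitData K M d | u.2.1 = s} :=
    ENNReal.toReal_pos (hE.strat_pos s).ne' (measure_ne_top _ _)
  have h1 : Tendsto (fun k => ∑ v, E.piHat (ns k) v s ω) atTop (𝓝 (∑ v, π v s)) :=
    tendsto_finsetSum _ fun v _ => hω (some v)
  refine tendsto_nhds_unique h1 (tendsto_const_nhds.congr' ?_)
  filter_upwards [(hω none).eventually_const_lt hp] with k hk
  have hne : (E.nStrat (ns k) s ω : ℝ) ≠ 0 := by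
    intro h0
    simp [h0] at hk
  simp only [Experiment.piHat]
  rw [← Finset.sum_div, eq_div_iff hne, one_mul, ← Nat.cast_sum, Nat.cast_inj]
  unfold Experiment.nStrat Experiment.nTreat
  rw [Finset.card_eq_sum_card_fiberwise (f := fun i => E.treat (ns k) i ω) (t := Finset.univ)
    (fun _ _ => Finset.mem_coe.2 (Finset.mem_univ _))]
  refine Finset.sum_congr rfl fun v _ => ?_
  rw [Finset.filter_filter]
  congr 1
  ext i
  simp [and_comm]

/-- The characteristic functions of `normalizedSum` converge to that of a centered Gaussian. -/
lemma tendsto_integral_exp_normalizedSum (hE : E.IsCAR P Q π)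
    {w w' : Fin K} {h₁ h₂ g : UnitData K M d → ℝ} (hh₁ : Measurable h₁) (hh₂ : Measurable h₂)
    (hg : Measurable g) {C : ℝ} (hb₁ : ∀ u, |h₁ u| ≤ C) (hb₂ : ∀ u, |h₂ u| ≤ C)
    (hbg : ∀ u, |g u| ≤ C) (hm₁ : ∀ s, ∫ u, h₁ u ∂(Q[|{u | u.2.1 = s}]) = 0)
    (hm₂ : ∀ s, ∫ u, h₂ u ∂(Q[|{u | u.2.1 = s}]) = 0)
    (hmg : ∀ s, ∫ u, g u ∂(Q[|{u | u.2.1 = s}]) = 0)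
    {ζ : Fin M → ℝ} (hζ : ∫ u, ζ u.2.1 ∂Q = 0) (t : ℝ) :
    Tendsto (fun n => ∫ ω, Complex.exp ((t * normalizedSum E w w' h₁ h₂ g ζ n ω : ℝ) * Complex.I) ∂P)
      atTop (𝓝 (Complex.exp ((-(t ^ 2) / 2 * limitVariance Q π w w' h₁ h₂ g ζ : ℝ) : ℂ))) := by
  -- conditional characteristic functions given the stratum
  let φ : ℕ → (Fin K → Fin M → ℝ) → Fin K × Fin M → ℂ := fun n c x =>
    ∫ u, Complex.exp ((t * score w w' h₁ h₂ g c x.1 x.2 u / √n : ℝ) * Complex.I)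
      ∂(Q[|{u | u.2.1 = x.2}])
  let A : ∀ n : ℕ, (Fin n → Fin M) × (Fin n → Fin K) → ℂ := fun n x =>
    ∏ i, φ n (treatFreq x.1 x.2) (x.2 i, x.1 i)
  let B : ∀ n : ℕ, (Fin n → Fin M) × (Fin n → Fin K) → ℂ := fun n x =>
    ∏ i, Complex.exp ((t * ζ (x.1 i) / √n : ℝ) * Complex.I)
  let vec : ∀ n : ℕ, Ω → (Fin n → Fin M) × (Fin n → Fin K) := fun n ω =>
    (fun i => E.strat n i ω, fun i => E.treat n i ω)
  let V₁ : ℝ := ∑ s, ∑ v, π v s * ∫ u in {u | u.2.1 = s}, score w w' h₁ h₂ g π v s u ^ 2 ∂Q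
  let c₀ : ℂ := Complex.exp ((-(t ^ 2) / 2 * V₁ : ℝ) : ℂ)
  have hφ1 : ∀ n c x, ‖φ n c x‖ ≤ 1 := by
    intro n c x
    have := hE.isProbabilityMeasure_cond x.2
    refine (norm_integral_le_of_norm_le_const (C := 1) (Eventually.of_forall fun u => ?_)).trans ?_
    · rw [Complex.norm_exp_ofReal_mul_I]
    · simp
  have hA1 : ∀ n x, ‖A n x‖ ≤ 1 := by
    intro n x
    simp only [A, norm_prod]
    exact Finset.prod_le_one (fun _ _ => norm_nonneg _) fun i _ => hφ1 _ _ _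
  have hB1 : ∀ n x, ‖B n x‖ = 1 := by
    intro n x
    simp only [B, norm_prod, Complex.norm_exp_ofReal_mul_I, Finset.prod_const_one]
  -- The estimated propensities are functions of the strata and treatment vectors, so they are
  -- constants under the conditioning, and so is the factor `B` coming from `ζ`.
  have hcond : ∀ n, ∫ ω, Complex.exp ((t * normalizedSum E w w' h₁ h₂ g ζ n ω : ℝ) * Complex.I) ∂P
      = ∫ ω, B n (vec n ω) * A n (vec n ω) ∂P := by
    intro n
    have key := hE.integral_prod_eq_integral_prod_cond n (fun sv wv i u =>
      Complex.exp ((t * ζ (sv i) / √n : ℝ) * Complex.I) *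
        Complex.exp ((t * score w w' h₁ h₂ g (treatFreq sv wv) (wv i) (sv i) u / √n : ℝ)
          * Complex.I)) ?_ ?_
    · calc _ = _ := ?_
        _ = _ := key
        _ = _ := ?_
      · congr 1
        ext ω
        simp only [← Complex.exp_add]
        rw [← Complex.exp_sum, normalizedSum, Finset.mul_sum, Finset.mul_sum, Complex.ofReal_sum,
          Finset.sum_mul]
        congr 1
        refine Finset.sum_congr rfl fun i _ => ?_
        simp only [piHat_eq_treatFreq]
        push_cast
        ring
      · congr 1
        ext ω
        simp only [A, B, φ, vec]
        rw [← Finset.prod_mul_distrib]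
        refine Finset.prod_congr rfl fun i _ => ?_
        rw [integral_const_mul]
    · intro sv wv i
      have := measurable_score (w := w) (w' := w') hh₁ hh₂ hg (treatFreq sv wv) (wv i) (sv i)
      fun_prop
    · intro sv wv i u
      rw [norm_mul, Complex.norm_exp_ofReal_mul_I, Complex.norm_exp_ofReal_mul_I, one_mul]
  have hAlim : Tendsto (fun n => ∫ ω, B n (vec n ω) * (A n (vec n ω) - c₀) ∂P) atTop (𝓝 0) := by
    refine hE.tendsto_integral_zero (C := 1 + ‖c₀‖) (fun n => ?_) (fun n ω => ?_) ?_
    · exact (hE.measurable_of_vectors n fun x => B n x * (A n x - c₀)).aestronglyMeasurable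
    · rw [norm_mul, hB1, one_mul]
      exact (norm_sub_le _ _).trans (by gcongr; exact hA1 _ _)
    · intro ω ns hns hπ hp
      -- Units in the same cell contribute the same factor; grouping by cell turns a product of
      -- growing length into a fixed finite product of powers.
      have hAn : ∀ n, A n (vec n ω) = ∏ x : Fin K × Fin M,
          φ n (fun v s => E.piHat n v s ω) x ^ E.nTreat n x.1 x.2 ω := by
        intro n
        simp only [A, vec]
        rw [← Finset.prod_fiberwise' Finset.univ (fun i => (E.treat n i ω, E.strat n i ω))
          (fun x => φ n (treatFreq (fun i : Fin n => E.strat n i ω) fun i => E.treat n i ω) x)]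
        refine Finset.prod_congr rfl fun x _ => ?_
        rw [Finset.prod_const]
        simp only [Experiment.nTreat, Prod.ext_iff]
        rfl
      have hq : ∀ x : Fin K × Fin M, Tendsto (fun j => (E.nTreat (ns j) x.1 x.2 ω : ℝ) / (ns j : ℕ))
          atTop (𝓝 (π x.1 x.2 * Q.real {u | u.2.1 = x.2})) := by
        intro x
        simp only [nTreat_div_eq]
        exact (hπ x.1 x.2).mul (hp x.2)
      have hmain := tendsto_prod_pow_exp (ι := Fin K × Fin M)
        (z := fun x j => φ (ns j) (fun v s => E.piHat (ns j) v s ω) x) hns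
        (fun x => hE.tendsto_natCast_mul_integral_score hh₁ hh₂ hg hb₁ hb₂ hbg hm₁ hm₂ hmg hns hπ t
          x.1 x.2) hq
      have hc₀ : Complex.exp (∑ x : Fin K × Fin M, ((π x.1 x.2 * Q.real {u | u.2.1 = x.2} : ℝ) : ℂ) *
          ((-(t ^ 2) / 2 * ∫ u, score w w' h₁ h₂ g π x.1 x.2 u ^ 2 ∂(Q[|{u | u.2.1 = x.2}]) : ℝ) : ℂ))
          = c₀ := by
        simp only [c₀, V₁]
        congr 1
        rw [Finset.sum_comm, ← Finset.univ_product_univ, Finset.sum_product, Finset.mul_sum,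
          Complex.ofReal_sum]
        refine Finset.sum_congr rfl fun v _ => ?_
        rw [Finset.mul_sum, Complex.ofReal_sum]
        refine Finset.sum_congr rfl fun s _ => ?_
        rw [← Complex.ofReal_mul, ← integral_cond_stratum (hE.strat_pos s), smul_eq_mul]
        congr 1
        ring
      rw [hc₀] at hmain
      have hsub : Tendsto (fun k => A (ns k) (vec (ns k) ω) - c₀) atTop (𝓝 0) := by
        simp only [hAn]
        simpa using hmain.sub_const c₀
      refine squeeze_zero_norm (fun k => ?_) (tendsto_zero_iff_norm_tendsto_zero.1 hsub)
      rw [norm_mul, hB1, one_mul]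
  have hζm : Measurable fun u : UnitData K M d => ζ u.2.1 :=
    (measurable_of_finite ζ).comp (measurable_fst.comp measurable_snd)
  have hBlim : Tendsto (fun n => ∫ ω, B n (vec n ω) ∂P) atTop
      (𝓝 (Complex.exp ((-(t ^ 2) / 2 * ∫ u, ζ u.2.1 ^ 2 ∂Q : ℝ) : ℂ))) := by
    -- `B` involves only the strata, which are i.i.d., so its mean is an `n`-th power and the
    -- ordinary central limit argument applies.
    have h1 : ∀ n : ℕ, ∫ ω, B n (vec n ω) ∂P
        = (∫ u : UnitData K M d, Complex.exp ((t * ζ u.2.1 / √n : ℝ) * Complex.I) ∂Q) ^ n := by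
      intro n
      have hm : Measurable fun u : UnitData K M d =>
          Complex.exp ((t * ζ u.2.1 / √n : ℝ) * Complex.I) := by fun_prop
      have h2 := (hE.indep n).integral_fun_prod_comp
        (f := fun _ u => Complex.exp ((t * ζ u.2.1 / √n : ℝ) * Complex.I))
        (fun i => (hE.measurable_unit n i).aemeasurable) (fun i => hm.aestronglyMeasurable)
      refine h2.trans ?_
      refine (Finset.prod_congr rfl fun i _ =>
        (hE.law n i).integral_comp (f := fun u => Complex.exp ((t * ζ u.2.1 / √n : ℝ) * Complex.I))
          hm.aestronglyMeasurable).trans ?_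
      simp
    obtain ⟨C', hC'⟩ := (Set.finite_range fun s => |ζ s|).bddAbove
    have h2 := tendsto_natCast_mul_integral_exp_sub_one Q (N := id)
      (a := fun _ u => ζ u.2.1) (a₀ := fun u => ζ u.2.1) (C := C') tendsto_id (fun _ => hζm)
      (Eventually.of_forall fun _ u => hC' ⟨u.2.1, rfl⟩) (fun u => tendsto_const_nhds)
      (fun _ => hζ) t
    have h3 := tendsto_pow_of_tendsto_mul_sub_one (k := id) (q := 1) tendsto_id h2 (by
      refine tendsto_const_nhds.congr' ?_
      filter_upwards [eventually_ge_atTop 1] with j hj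
      have : (j : ℝ) ≠ 0 := by exact_mod_cast (by omega : j ≠ 0)
      simp [this])
    simp only [h1]
    simpa using h3
  -- Decompose `E[B A] = E[B (A - c₀)] + E[B] c₀`: `A` and `B` are dependent, but `A` tends to a
  -- constant and `B` has modulus one.
  have hfinal := hAlim.add (hBlim.mul_const c₀)
  have hval : 0 + Complex.exp ((-(t ^ 2) / 2 * ∫ u, ζ u.2.1 ^ 2 ∂Q : ℝ) : ℂ) * c₀
      = Complex.exp ((-(t ^ 2) / 2 * limitVariance Q π w w' h₁ h₂ g ζ : ℝ) : ℂ) := by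
    simp only [c₀, V₁]
    rw [zero_add, ← Complex.exp_add, ← Complex.ofReal_add, limitVariance]
    congr 2
    ring
  rw [hval] at hfinal
  refine hfinal.congr fun n => ?_
  have hBi : Integrable (fun ω => B n (vec n ω)) P :=
    Integrable.of_bound (hE.measurable_of_vectors n (B n)).aestronglyMeasurable 1
      (Eventually.of_forall fun ω => (hB1 _ _).le)
  have hBAi : Integrable (fun ω => B n (vec n ω) * A n (vec n ω)) P :=
    Integrable.of_bound (hE.measurable_of_vectors n fun x => B n x * A n x).aestronglyMeasurable 1
      (Eventually.of_forall fun ω => by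
        rw [norm_mul, hB1, one_mul]; exact hA1 _ _)
  rw [hcond n, ← integral_mul_const]
  simp only [mul_sub]
  rw [integral_sub hBAi (hBi.mul_const _)]
  ring

end Experiment.IsCAR

end

end CAR

/-! ### From the estimators to the normalized sum. -/

namespace CAR

noncomputable section

variable {Ω : Type*} {K M d : ℕ}

/-- The indicator of `Y(w) ≤ y`. -/
def outcomeInd (w : Fin K) (y : ℝ) (u : UnitData K M d) : ℝ := if u.1 w ≤ y then 1 else 0

/-- An adjustment term, as a function of the characteristics of a unit. -/
def adjTerm (m : Fin M → (Fin d → ℝ) → ℝ) (u : UnitData K M d) : ℝ := m u.2.1 u.2.2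

/-- The mean of `f` within the stratum `s`. -/
def stratumMean (Q : Measure (UnitData K M d)) (f : UnitData K M d → ℝ) (s : Fin M) : ℝ :=
  ∫ u, f u ∂(Q[|{u | u.2.1 = s}])

/-- `f`, centered within strata. -/
def centered (Q : Measure (UnitData K M d)) (f : UnitData K M d → ℝ) (u : UnitData K M d) : ℝ :=
  f u - stratumMean Q f u.2.1

lemma abs_outcomeInd_le (w : Fin K) (y : ℝ) (u : UnitData K M d) : |outcomeInd w y u| ≤ 1 := by
  unfold outcomeInd
  split_ifs <;> simp

lemma measurable_outcomeInd (w : Fin K) (y : ℝ) :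
    Measurable (outcomeInd w y : UnitData K M d → ℝ) := by
  refine Measurable.ite (measurableSet_le ?_ measurable_const) measurable_const measurable_const
  fun_prop

lemma measurable_stratumMean (Q : Measure (UnitData K M d)) (f : UnitData K M d → ℝ) :
    Measurable fun u : UnitData K M d => stratumMean Q f u.2.1 :=
  (measurable_of_finite (stratumMean Q f)).comp (measurable_fst.comp measurable_snd)

lemma measurable_centered (Q : Measure (UnitData K M d)) {f : UnitData K M d → ℝ}
    (hf : Measurable f) : Measurable (centered Q f) :=
  hf.sub (measurable_stratumMean Q f)

lemma abs_stratumMean_le (Q : Measure (UnitData K M d)) {f : UnitData K M d → ℝ} {C : ℝ}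
    (hC : 0 ≤ C) (hf : ∀ u, |f u| ≤ C) (s : Fin M) : |stratumMean Q f s| ≤ C := by
  unfold stratumMean
  refine (norm_integral_le_of_norm_le_const (f := f) (Eventually.of_forall hf)).trans ?_
  exact mul_le_of_le_one_right hC measureReal_le_one

lemma abs_centered_le (Q : Measure (UnitData K M d)) {f : UnitData K M d → ℝ} {C : ℝ}
    (hC : 0 ≤ C) (hf : ∀ u, |f u| ≤ C) (u : UnitData K M d) : |centered Q f u| ≤ 2 * C := by
  have := abs_stratumMean_le Q hC hf u.2.1
  refine (abs_sub _ _).trans ?_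
  linarith [hf u]

lemma ae_cond_stratum (Q : Measure (UnitData K M d)) (s : Fin M) :
    ∀ᵐ u ∂(Q[|{u | u.2.1 = s}]), u.2.1 = s :=
  ae_cond_mem (measurableSet_stratum s)

/-- Removing the estimated propensity from a sum over the units with treatment `w`. -/
lemma sum_treat_inv_piHat_mul (E : Experiment Ω K M d) (n : ℕ) (w : Fin K) (ω : Ω)
    (h : ∀ s, E.piHat n w s ω ≠ 0) (κ : Fin M → ℝ) :
    ∑ i : Fin n, (if E.treat n i ω = w then (E.piHat n w (E.strat n i ω) ω)⁻¹ else 0)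
        * κ (E.strat n i ω)
      = ∑ i : Fin n, κ (E.strat n i ω) := by
  -- Stratum by stratum, the left side is `n_w(s) * (n(s) / n_w(s)) * κ s = n(s) * κ s`.
  rw [← Finset.sum_fiberwise Finset.univ (fun i => E.strat n i ω),
    ← Finset.sum_fiberwise Finset.univ (fun i => E.strat n i ω) (fun i => κ (E.strat n i ω))]
  refine Finset.sum_congr rfl fun s _ => ?_
  have e1 : ∑ i with E.strat n i ω = s, κ (E.strat n i ω) = E.nStrat n s ω * κ s := by
    rw [Finset.sum_congr rfl (g := fun _ => κ s) fun i hi => by rw [(Finset.mem_filter.1 hi).2]]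
    simp [Experiment.nStrat]
  have e2 : ∑ i with E.strat n i ω = s,
      (if E.treat n i ω = w then (E.piHat n w (E.strat n i ω) ω)⁻¹ else 0) * κ (E.strat n i ω)
      = E.nTreat n w s ω * ((E.piHat n w s ω)⁻¹ * κ s) := by
    rw [Finset.sum_congr rfl (g := fun i => if E.treat n i ω = w then
      (E.piHat n w s ω)⁻¹ * κ s else 0) fun i hi => by
        rw [(Finset.mem_filter.1 hi).2, ite_mul, zero_mul], ← Finset.sum_filter,
      Finset.filter_filter, Finset.sum_const, nsmul_eq_mul]
    simp only [Experiment.nTreat, and_comm]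
  rw [e1, e2]
  have hs := h s
  unfold Experiment.piHat at hs ⊢
  have h1 : (E.nTreat n w s ω : ℝ) ≠ 0 := fun h0 => hs (by simp [h0])
  rw [inv_div]
  field_simp

/-- Where the weight is nonzero the unit received `w`, so its observed outcome may be replaced by
its potential outcome under `w`. -/
lemma cdfAIPW_eq (E : Experiment Ω K M d) (m : Fin M → (Fin d → ℝ) → ℝ) (n : ℕ) (w : Fin K) (y : ℝ)
    (ω : Ω) :
    E.cdfAIPW m n w y ω = (1 / (n : ℝ)) * ∑ i : Fin n,
      ((if E.treat n i ω = w then (E.piHat n w (E.strat n i ω) ω)⁻¹ else 0)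
        * (outcomeInd w y (E.unit n i ω) - adjTerm m (E.unit n i ω))
        + adjTerm m (E.unit n i ω)) := by
  unfold Experiment.cdfAIPW
  congr 1
  refine Finset.sum_congr rfl fun i _ => ?_
  by_cases h : E.treat n i ω = w
  · have hobs : (if E.obs n i ω ≤ y then (1 : ℝ) else 0) = outcomeInd w y (E.unit n i ω) := by
      by_cases hy : E.pot n i w ω ≤ y <;>
        simp [Experiment.obs, outcomeInd, Experiment.unit, h, hy]
    simp only [hobs, h, if_true, adjTerm, Experiment.unit]
    ring
  · simp [h, adjTerm, Experiment.unit]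

lemma cdfEmp_eq_cdfAIPW (E : Experiment Ω K M d) (n : ℕ) (w : Fin K) (y : ℝ) (ω : Ω) :
    E.cdfEmp n w y ω = E.cdfAIPW (fun _ _ => 0) n w y ω := by
  simp [Experiment.cdfEmp, Experiment.cdfAIPW]

lemma stratumMean_sub (Q : Measure (UnitData K M d)) {f g : UnitData K M d → ℝ} {s : Fin M}
    (hf : Integrable f (Q[|{u | u.2.1 = s}])) (hg : Integrable g (Q[|{u | u.2.1 = s}])) :
    stratumMean Q (fun u => f u - g u) s = stratumMean Q f s - stratumMean Q g s :=
  integral_sub hf hg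

lemma integrable_of_abs_le {α : Type*} [MeasurableSpace α] (μ : Measure α) [IsFiniteMeasure μ]
    {f : α → ℝ} (hf : Measurable f) {C : ℝ} (hC : ∀ u, |f u| ≤ C) : Integrable f μ :=
  Integrable.of_bound hf.aestronglyMeasurable C (Eventually.of_forall hC)

/-- An exact identity, with no remainder. The stratum means removed from the weighted terms sum to
the same amount as without weights, by `sum_treat_inv_piHat_mul`; the adjustment means then cancel,
and only the stratum means of the outcome indicators remain, in `ζ`. -/
lemma sqrt_mul_cdfAIPW_sub (E : Experiment Ω K M d) (Q : Measure (UnitData K M d))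
    {m₁ m₂ : Fin M → (Fin d → ℝ) → ℝ}
    (hm₁ : Measurable (adjTerm m₁ : UnitData K M d → ℝ))
    (hm₂ : Measurable (adjTerm m₂ : UnitData K M d → ℝ)) {C : ℝ}
    (hb₁ : ∀ s x, |m₁ s x| ≤ C) (hb₂ : ∀ s x, |m₂ s x| ≤ C) (w w' : Fin K) (y θ : ℝ) {n : ℕ}
    (hn : n ≠ 0) (ω : Ω) (hw : ∀ s, E.piHat n w s ω ≠ 0) (hw' : ∀ s, E.piHat n w' s ω ≠ 0) :
    √n * (E.cdfAIPW m₁ n w y ω - E.cdfAIPW m₂ n w' y ω - θ)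
      = normalizedSum E w w' (centered Q fun u => outcomeInd w y u - adjTerm m₁ u)
        (centered Q fun u => outcomeInd w' y u - adjTerm m₂ u)
        (centered Q fun u => adjTerm m₁ u - adjTerm m₂ u)
        (fun s => stratumMean Q (outcomeInd w y) s - stratumMean Q (outcomeInd w' y) s - θ) n ω := by
  have hD : ∀ (v : Fin K) s, Integrable (outcomeInd v y) (Q[|{u | u.2.1 = s}]) := fun v s =>
    integrable_of_abs_le _ (measurable_outcomeInd v y) (abs_outcomeInd_le v y)
  have hi₁ : ∀ s, Integrable (adjTerm m₁) (Q[|{u | u.2.1 = s}]) := fun s =>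
    integrable_of_abs_le _ hm₁ fun u => hb₁ _ _
  have hi₂ : ∀ s, Integrable (adjTerm m₂) (Q[|{u | u.2.1 = s}]) := fun s =>
    integrable_of_abs_le _ hm₂ fun u => hb₂ _ _
  have hn' : (n : ℝ) ≠ 0 := by exact_mod_cast hn
  have hsqrt : (√n)⁻¹ = √n * (1 / (n : ℝ)) := by
    have h0 : √(n : ℝ) ≠ 0 := (Real.sqrt_pos.2 (by positivity)).ne'
    field_simp
    rw [Real.sq_sqrt (Nat.cast_nonneg n)]
  have hθ : θ = (1 / (n : ℝ)) * ∑ _i : Fin n, θ := by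
    simp [hn']
  have harm := fun (v : Fin K) (hv : ∀ s, E.piHat n v s ω ≠ 0) (κ : Fin M → ℝ) =>
    sum_treat_inv_piHat_mul E n v ω hv κ
  rw [cdfAIPW_eq, cdfAIPW_eq, normalizedSum, hsqrt, mul_assoc]
  congr 1
  conv_lhs => rw [hθ]
  rw [← mul_sub, ← mul_sub]
  congr 1
  have e₁ := harm w hw fun s => stratumMean Q (fun u => outcomeInd w y u - adjTerm m₁ u) s
  have e₂ := harm w' hw' fun s => stratumMean Q (fun u => outcomeInd w' y u - adjTerm m₂ u) s
  rw [← sub_eq_zero] at e₁ e₂ ⊢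
  rw [← Finset.sum_sub_distrib] at e₁ e₂
  simp only [← Finset.sum_sub_distrib]
  have e₃ := congrArg₂ (fun a b : ℝ => a - b) e₁ e₂
  simp only [sub_zero, ← Finset.sum_sub_distrib] at e₃
  refine Eq.trans (Finset.sum_congr rfl fun i _ => ?_) e₃
  simp only [score, centered, Experiment.unit]
  rw [stratumMean_sub Q (hi₁ _) (hi₂ _), stratumMean_sub Q (hD w _) (hi₁ _),
    stratumMean_sub Q (hD w' _) (hi₂ _)]
  ring

variable [MeasurableSpace Ω] {P : Measure Ω}
  {E : Experiment Ω K M d} {Q : Measure (UnitData K M d)} {π : Fin K → Fin M → ℝ}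

lemma measurable_cdfAIPW (hE : E.IsCAR P Q π) {m : Fin M → (Fin d → ℝ) → ℝ}
    (hm : Measurable (adjTerm m : UnitData K M d → ℝ)) (n : ℕ) (w : Fin K) (y : ℝ) :
    Measurable (E.cdfAIPW m n w y) := by
  have : E.cdfAIPW m n w y = _ := funext fun ω => cdfAIPW_eq E m n w y ω
  rw [this]
  refine (Finset.measurable_fun_sum _ fun i _ => ?_).const_mul _
  have h1 := hE.measurable_of_vectors n
    (fun x => if x.2 i = w then (treatFreq x.1 x.2 w (x.1 i))⁻¹ else 0)
  exact (h1.mul (((measurable_outcomeInd w y).comp (hE.measurable_unit n i)).sub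
    (hm.comp (hE.measurable_unit n i)))).add (hm.comp (hE.measurable_unit n i))

lemma integral_centered_cond [IsFiniteMeasure Q] {s : Fin M} (hs : 0 < Q {u | u.2.1 = s})
    {f : UnitData K M d → ℝ} (hf : Integrable f (Q[|{u | u.2.1 = s}])) :
    ∫ u, centered Q f u ∂(Q[|{u | u.2.1 = s}]) = 0 := by
  have := cond_isProbabilityMeasure (μ := Q) hs.ne'
  have : ∫ u, centered Q f u ∂(Q[|{u | u.2.1 = s}])
      = ∫ u, (f u - stratumMean Q f s) ∂(Q[|{u | u.2.1 = s}]) := by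
    refine integral_congr_ae ?_
    filter_upwards [ae_cond_stratum Q s] with u hu
    rw [centered, hu]
  rw [this, integral_sub hf (integrable_const _)]
  simp [stratumMean]

lemma integral_stratumMean [IsFiniteMeasure Q] (hQ : ∀ s, 0 < Q {u | u.2.1 = s})
    {f : UnitData K M d → ℝ} (hf : Integrable f Q) :
    ∫ u, stratumMean Q f u.2.1 ∂Q = ∫ u, f u ∂Q := by
  obtain ⟨C, hC⟩ := (Set.finite_range fun s => |stratumMean Q f s|).bddAbove
  rw [integral_eq_sum_stratum (integrable_of_abs_le Q (measurable_stratumMean Q f)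
    fun u => hC ⟨u.2.1, rfl⟩), integral_eq_sum_stratum hf]
  refine Finset.sum_congr rfl fun s _ => ?_
  have hconst : Set.EqOn (fun u : UnitData K M d => stratumMean Q f u.2.1)
      (fun _ => stratumMean Q f s) {u | u.2.1 = s} := fun u hu =>
    congrArg (stratumMean Q f) hu
  rw [setIntegral_congr_fun (measurableSet_stratum s) hconst, setIntegral_const,
    ← integral_cond_stratum (hQ s), stratumMean]

lemma integral_outcomeInd (w : Fin K) (y : ℝ) : ∫ u, outcomeInd w y u ∂Q = popCDF Q w y := by
  have hms : MeasurableSet {u : UnitData K M d | u.1 w ≤ y} :=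
    measurableSet_le (by fun_prop) measurable_const
  have : (outcomeInd w y : UnitData K M d → ℝ) = Set.indicator {u | u.1 w ≤ y} fun _ => 1 := by
    ext u
    simp [outcomeInd, Set.indicator_apply]
  rw [this, integral_indicator_const _ hms]
  simp [popCDF]

lemma limitVariance_nonneg (hE : E.IsCAR P Q π) (w w' : Fin K) (h₁ h₂ g : UnitData K M d → ℝ)
    (ζ : Fin M → ℝ) : 0 ≤ limitVariance Q π w w' h₁ h₂ g ζ := by
  refine add_nonneg (Finset.sum_nonneg fun s _ => Finset.sum_nonneg fun v _ =>
    mul_nonneg (hE.target_mem v s).1.le ?_) ?_ <;>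
  exact integral_nonneg fun u => sq_nonneg _

/-- Asymptotic normality of the regression-adjusted estimator with arbitrary bounded adjustment
terms. -/
lemma hasAsymptoticVariance_cdfAIPW_sub [IsProbabilityMeasure P] [IsProbabilityMeasure Q]
    (hE : E.IsCAR P Q π) {m₁ m₂ : Fin M → (Fin d → ℝ) → ℝ}
    (hm₁ : Measurable (adjTerm m₁ : UnitData K M d → ℝ))
    (hm₂ : Measurable (adjTerm m₂ : UnitData K M d → ℝ)) {C : ℝ} (hC : 0 ≤ C)
    (hb₁ : ∀ s x, |m₁ s x| ≤ C) (hb₂ : ∀ s x, |m₂ s x| ≤ C) (w w' : Fin K) (y : ℝ) :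
    HasAsymptoticVariance P (fun n ω => E.cdfAIPW m₁ n w y ω - E.cdfAIPW m₂ n w' y ω)
      (dte Q w w' y)
      (limitVariance Q π w w' (centered Q fun u => outcomeInd w y u - adjTerm m₁ u)
        (centered Q fun u => outcomeInd w' y u - adjTerm m₂ u)
        (centered Q fun u => adjTerm m₁ u - adjTerm m₂ u)
        fun s => stratumMean Q (outcomeInd w y) s - stratumMean Q (outcomeInd w' y) s
          - dte Q w w' y).toNNReal := by
  set h₁ := centered Q fun u => outcomeInd w y u - adjTerm m₁ u
  set h₂ := centered Q fun u => outcomeInd w' y u - adjTerm m₂ u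
  set g := centered Q fun u => adjTerm m₁ u - adjTerm m₂ u
  set ζ := fun s => stratumMean Q (outcomeInd w y) s - stratumMean Q (outcomeInd w' y) s
          - dte Q w w' y with hζ
  have hmeas : ∀ n : ℕ, Measurable fun ω =>
      √n * (E.cdfAIPW m₁ n w y ω - E.cdfAIPW m₂ n w' y ω - dte Q w w' y) := fun n =>
    (((measurable_cdfAIPW hE hm₁ n w y).sub (measurable_cdfAIPW hE hm₂ n w' y)).sub_const
      _).const_mul _
  have hD : ∀ v, Measurable (outcomeInd v y : UnitData K M d → ℝ) := fun v =>
    measurable_outcomeInd v y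
  have b₁ : ∀ u : UnitData K M d, |outcomeInd w y u - adjTerm m₁ u| ≤ 1 + 2 * C := fun u =>
    (abs_sub _ _).trans (by
      have h1 := abs_outcomeInd_le w y u
      have h2 : |adjTerm m₁ u| ≤ C := hb₁ _ _
      linarith)
  have b₂ : ∀ u : UnitData K M d, |outcomeInd w' y u - adjTerm m₂ u| ≤ 1 + 2 * C := fun u =>
    (abs_sub _ _).trans (by
      have h1 := abs_outcomeInd_le w' y u
      have h2 : |adjTerm m₂ u| ≤ C := hb₂ _ _
      linarith)
  have bg : ∀ u : UnitData K M d, |adjTerm m₁ u - adjTerm m₂ u| ≤ 1 + 2 * C := fun u =>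
    (abs_sub _ _).trans (by
      have h1 : |adjTerm m₁ u| ≤ C := hb₁ _ _
      have h2 : |adjTerm m₂ u| ≤ C := hb₂ _ _
      linarith)
  have hC' : 0 ≤ 1 + 2 * C := by positivity
  have hζ0 : ∫ u, ζ u.2.1 ∂Q = 0 := by
    have hi : ∀ v : Fin K, Integrable (outcomeInd v y) Q := fun v =>
      integrable_of_abs_le _ (hD v) (abs_outcomeInd_le v y)
    have hi' : ∀ v : Fin K, Integrable (fun u => stratumMean Q (outcomeInd v y) u.2.1) Q := fun v =>
      integrable_of_abs_le _ (measurable_stratumMean Q _)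
        fun u => abs_stratumMean_le Q zero_le_one (abs_outcomeInd_le v y) u.2.1
    simp only [hζ]
    rw [integral_sub ((hi' w).sub' (hi' w')) (integrable_const _), integral_sub (hi' w) (hi' w'),
      integral_stratumMean hE.strat_pos (hi w), integral_stratumMean hE.strat_pos (hi w'),
      integral_outcomeInd, integral_outcomeInd]
    simp [dte]
  have hclt : ∀ t : ℝ, Tendsto (fun n => ∫ ω, Complex.exp
      ((t * normalizedSum E w w' h₁ h₂ g ζ n ω : ℝ) * Complex.I) ∂P) atTop
      (𝓝 (Complex.exp ((-(t ^ 2) / 2 * limitVariance Q π w w' h₁ h₂ g ζ : ℝ) : ℂ))) :=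
    hE.tendsto_integral_exp_normalizedSum (w := w) (w' := w')
    (measurable_centered Q ((hD w).sub hm₁)) (measurable_centered Q ((hD w').sub hm₂))
    (measurable_centered Q (hm₁.sub hm₂)) (abs_centered_le Q hC' b₁) (abs_centered_le Q hC' b₂)
    (abs_centered_le Q hC' bg)
    (fun s => integral_centered_cond (hE.strat_pos s) (integrable_of_abs_le _ ((hD w).sub hm₁) b₁))
    (fun s => integral_centered_cond (hE.strat_pos s) (integrable_of_abs_le _ ((hD w').sub hm₂) b₂))
    (fun s => integral_centered_cond (hE.strat_pos s) (integrable_of_abs_le _ (hm₁.sub hm₂) bg))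
    hζ0
  have hmeasZ : ∀ n, Measurable (normalizedSum E w w' h₁ h₂ g ζ n) := by
    intro n
    refine (Finset.measurable_fun_sum _ fun i _ => Measurable.add ?_ ?_).const_mul _
    · have f1 := hE.measurable_of_vectors n
        (fun x => if x.2 i = w then (treatFreq x.1 x.2 w (x.1 i))⁻¹ else 0)
      have f2 := hE.measurable_of_vectors n
        (fun x => if x.2 i = w' then (treatFreq x.1 x.2 w' (x.1 i))⁻¹ else 0)
      exact ((f1.mul ((measurable_centered Q ((hD w).sub hm₁)).comp (hE.measurable_unit n i))).sub
        (f2.mul ((measurable_centered Q ((hD w').sub hm₂)).comp (hE.measurable_unit n i)))).add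
        ((measurable_centered Q (hm₁.sub hm₂)).comp (hE.measurable_unit n i))
    · exact (measurable_of_finite ζ).comp (hE.measurable_strat n i)
  refine ⟨fun n => (hmeas n).aemeasurable, aemeasurable_id, ?_⟩
  refine ProbabilityMeasure.tendsto_of_tendsto_charFun fun t => ?_
  -- Along a subsequence with converging frequencies the propensities are eventually nonzero, since
  -- the targets are positive. The two exponentials are then equal, so the integrand is eventually
  -- `0`.
  have hdiff : Tendsto (fun n : ℕ => ∫ ω, (Complex.exp ((t * (√n * (E.cdfAIPW m₁ n w y ω
        - E.cdfAIPW m₂ n w' y ω - dte Q w w' y)) : ℝ) * Complex.I)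
      - Complex.exp ((t * normalizedSum E w w' h₁ h₂ g ζ n ω : ℝ) * Complex.I)) ∂P) atTop
      (𝓝 0) := by
    refine hE.tendsto_integral_zero (C := 2) (fun n => ?_) (fun n ω => ?_) ?_
    · have f1 := hmeas n
      have f2 := hmeasZ n
      exact Measurable.aestronglyMeasurable (by fun_prop)
    · refine (norm_sub_le _ _).trans ?_
      rw [Complex.norm_exp_ofReal_mul_I, Complex.norm_exp_ofReal_mul_I]
      norm_num
    · intro ω ns hns hπ _
      have hne : ∀ v, ∀ᶠ k in atTop, ∀ s, E.piHat (ns k) v s ω ≠ 0 := fun v =>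
        eventually_all.2 fun s => (hπ v s).eventually_ne (hE.target_mem v s).1.ne'
      refine tendsto_const_nhds.congr' ?_
      filter_upwards [hne w, hne w', hns.eventually_ge_atTop 1] with k hk hk' hk1
      rw [sqrt_mul_cdfAIPW_sub E Q hm₁ hm₂ hb₁ hb₂ w w' y (dte Q w w' y) (by omega) ω hk hk',
        sub_self]
  have hsum := hdiff.add (hclt t)
  rw [zero_add] at hsum
  have hlim : charFun (Measure.map id (gaussianReal 0 (limitVariance Q π w w' h₁ h₂ g ζ).toNNReal)) t
      = Complex.exp ((-(t ^ 2) / 2 * limitVariance Q π w w' h₁ h₂ g ζ : ℝ) : ℂ) := by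
    rw [Measure.map_id, charFun_gaussianReal,
      Real.coe_toNNReal _ (limitVariance_nonneg hE w w' h₁ h₂ g ζ)]
    congr 1
    push_cast
    ring
  change Tendsto (fun n : ℕ => charFun (P.map fun ω => √n * (E.cdfAIPW m₁ n w y ω
    - E.cdfAIPW m₂ n w' y ω - dte Q w w' y)) t) atTop (𝓝 (charFun (Measure.map id
      (gaussianReal 0 (limitVariance Q π w w' h₁ h₂ g ζ).toNNReal)) t))
  rw [hlim]
  refine hsum.congr fun n => ?_
  have hexp : ∀ Z : Ω → ℝ, Measurable Z →
      Integrable (fun ω => Complex.exp ((t * Z ω : ℝ) * Complex.I)) P := fun Z hZ =>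
    Integrable.of_bound (C := 1) (Measurable.aestronglyMeasurable (by fun_prop))
      (Eventually.of_forall fun ω => by rw [Complex.norm_exp_ofReal_mul_I])
  rw [integral_sub (hexp _ (hmeas n)) (hexp _ (hmeasZ n)), sub_add_cancel, charFun_apply_real,
    integral_map (hmeas n).aemeasurable (by fun_prop)]
  push_cast
  rfl

/-! ### The conditional distribution function as a projection onto functions of stratum and
covariates. -/

lemma measurable_adjTerm_condCDF [IsFiniteMeasure Q] (w : Fin K) (y : ℝ) :
    Measurable (adjTerm (condCDF Q w y) : UnitData K M d → ℝ) :=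
  ((Kernel.measurable_coe (condDistrib (fun u : UnitData K M d => u.1 w)
    (fun u : UnitData K M d => u.2) Q) measurableSet_Iic).comp measurable_snd).ennreal_toReal

lemma abs_condCDF_le [IsFiniteMeasure Q] (w : Fin K) (y : ℝ) (s : Fin M) (x : Fin d → ℝ) :
    |condCDF Q w y s x| ≤ 1 := by
  rw [condCDF, abs_of_nonneg measureReal_nonneg]
  exact measureReal_le_one

/-- The error of the conditional distribution function is orthogonal to functions of the stratum
and the covariates. -/
lemma integral_mul_outcomeInd_sub_condCDF [IsFiniteMeasure Q] (w : Fin K) (y : ℝ)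
    {ψ : Fin M × (Fin d → ℝ) → ℝ} (hψ : Measurable ψ) {C : ℝ} (hC : ∀ x, |ψ x| ≤ C) :
    ∫ u, ψ u.2 * (outcomeInd w y u - adjTerm (condCDF Q w y) u) ∂Q = 0 := by
  have hY : Measurable fun u : UnitData K M d => u.1 w := by fun_prop
  have hX : Measurable fun u : UnitData K M d => u.2 := measurable_snd
  have hce := condDistrib_ae_eq_condExp (μ := Q) hX hY (measurableSet_Iic (a := y))
  have hDeq : (outcomeInd w y : UnitData K M d → ℝ)
      = ((fun u : UnitData K M d => u.1 w) ⁻¹' Set.Iic y).indicator fun _ => 1 := by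
    ext u
    by_cases h : u.1 w ≤ y <;> simp [outcomeInd, h]
  have hDi : Integrable (outcomeInd w y) Q :=
    integrable_of_abs_le _ (measurable_outcomeInd w y) (abs_outcomeInd_le w y)
  have hmul : ∀ f : UnitData K M d → ℝ, Integrable f Q → Integrable (fun u => ψ u.2 * f u) Q :=
    fun f hf => hf.bdd_mul (hψ.comp hX).aestronglyMeasurable (Eventually.of_forall fun u => hC u.2)
  have hμi : Integrable (adjTerm (condCDF Q w y)) Q :=
    integrable_of_abs_le _ (measurable_adjTerm_condCDF w y) fun u => abs_condCDF_le w y _ _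
  have hψm : StronglyMeasurable[MeasurableSpace.comap (fun u : UnitData K M d => u.2) inferInstance]
      fun u : UnitData K M d => ψ u.2 :=
    (hψ.comp (comap_measurable _)).stronglyMeasurable
  -- Pull the factor `ψ`, measurable in stratum and covariates, out of the conditional expectation;
  -- what remains is the conditional distribution function.
  have h1 := condExp_mul_of_stronglyMeasurable_left hψm (hmul _ hDi) hDi
  have h2 : ∫ u, ψ u.2 * outcomeInd w y u ∂Q = ∫ u, ψ u.2 * adjTerm (condCDF Q w y) u ∂Q := by
    rw [← integral_condExp hX.comap_le]
    refine integral_congr_ae ?_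
    filter_upwards [h1, hce] with u hu hu'
    refine hu.trans ?_
    simp only [Pi.mul_apply]
    rw [hDeq, ← hu']
    rfl
  simp only [mul_sub]
  rw [integral_sub (hmul _ hDi) (hmul _ hμi), h2, sub_self]

end

end CAR

/-! ### Comparison of the limiting variances. -/

namespace CAR

noncomputable section

variable {Ω : Type*} {K M d : ℕ} [MeasurableSpace Ω] {P : Measure Ω}
  {E : Experiment Ω K M d} {Q : Measure (UnitData K M d)} {π : Fin K → Fin M → ℝ}

/-- The indicator of a stratum is itself a function of stratum and covariates, so it can be absorbed
into `ψ`. -/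
lemma setIntegral_mul_outcomeInd_sub_condCDF [IsFiniteMeasure Q] (w : Fin K) (y : ℝ) (s : Fin M)
    {ψ : Fin M × (Fin d → ℝ) → ℝ} (hψ : Measurable ψ) {C : ℝ} (hC : ∀ x, |ψ x| ≤ C) :
    ∫ u in {u | u.2.1 = s}, ψ u.2 * (outcomeInd w y u - adjTerm (condCDF Q w y) u) ∂Q = 0 := by
  have hms : MeasurableSet {x : Fin M × (Fin d → ℝ) | x.1 = s} :=
    measurable_fst (measurableSet_singleton s)
  rw [← integral_indicator (measurableSet_stratum s),
    ← integral_mul_outcomeInd_sub_condCDF (Q := Q) w y (hψ.indicator hms) (C := C) fun x => ?_]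
  · congr 1
    ext u
    by_cases h : u.2.1 = s <;> simp [Set.indicator, h]
  · by_cases h : x.1 = s
    · simpa [Set.indicator, h] using hC x
    · simpa [Set.indicator, h] using (abs_nonneg _).trans (hC x)

lemma stratumMean_outcomeInd_sub_condCDF [IsFiniteMeasure Q] (w : Fin K) (y : ℝ) (s : Fin M) :
    stratumMean Q (fun u => outcomeInd w y u - adjTerm (condCDF Q w y) u) s = 0 := by
  have := setIntegral_mul_outcomeInd_sub_condCDF (Q := Q) w y s (ψ := fun _ => 1)
    measurable_const (C := 1) (by simp)
  simp only [one_mul] at this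
  rw [stratumMean, ProbabilityTheory.cond, integral_smul_measure, this, smul_zero]

/-- The sum is the variance of `x` under the weights `p`, namely `∑ i, p i * (x i - z) ^ 2`. -/
lemma sum_mul_sq_sub_sq_nonneg {ι : Type*} [Fintype ι] {p x : ι → ℝ} {z : ℝ} (hp : ∀ i, 0 ≤ p i)
    (hp1 : ∑ i, p i = 1) (hx : ∑ i, p i * x i = z) : 0 ≤ ∑ i, p i * (x i ^ 2 - z ^ 2) := by
  have : ∑ i, p i * (x i ^ 2 - z ^ 2) = ∑ i, p i * (x i - z) ^ 2 := by
    rw [← sub_eq_zero, ← Finset.sum_sub_distrib]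
    calc _ = ∑ i, (2 * z * (p i * x i) - 2 * z ^ 2 * p i) :=
          Finset.sum_congr rfl fun i _ => by ring
      _ = 0 := by
          rw [Finset.sum_sub_distrib, ← Finset.mul_sum, ← Finset.mul_sum, hx, hp1]
          ring
  rw [this]
  exact Finset.sum_nonneg fun i _ => mul_nonneg (hp i) (sq_nonneg _)

/-- Adjusting by the conditional distribution functions does not increase the limiting variance. -/
lemma limitVariance_condCDF_le [IsProbabilityMeasure P] [IsProbabilityMeasure Q]
    (hE : E.IsCAR P Q π) (w w' : Fin K) (y : ℝ) (ζ : Fin M → ℝ) :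
    limitVariance Q π w w' (centered Q fun u => outcomeInd w y u - adjTerm (condCDF Q w y) u)
        (centered Q fun u => outcomeInd w' y u - adjTerm (condCDF Q w' y) u)
        (centered Q fun u => adjTerm (condCDF Q w y) u - adjTerm (condCDF Q w' y) u) ζ
      ≤ limitVariance Q π w w' (centered Q fun u => outcomeInd w y u - adjTerm (fun _ _ => 0) u)
        (centered Q fun u => outcomeInd w' y u - adjTerm (fun _ _ => 0) u)
        (centered Q fun u => adjTerm (fun _ _ => 0) u - adjTerm (fun _ _ => 0) u) ζ := by
  unfold limitVariance
  refine add_le_add (Finset.sum_le_sum fun s _ => ?_) le_rfl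
  -- within-stratum residuals and centered conditional distribution functions
  let e : Fin K → UnitData K M d → ℝ := fun v u => outcomeInd v y u - adjTerm (condCDF Q v y) u
  let k : Fin K → Fin M × (Fin d → ℝ) → ℝ := fun v x =>
    condCDF Q v y x.1 x.2 - stratumMean Q (adjTerm (condCDF Q v y)) x.1
  let α : Fin K → Fin K → ℝ := fun x v => if v = x then (π x s)⁻¹ else 0
  have hD : ∀ v, Measurable (outcomeInd v y : UnitData K M d → ℝ) := fun v =>
    measurable_outcomeInd v y
  have hμ : ∀ v, Measurable (adjTerm (condCDF Q v y) : UnitData K M d → ℝ) := fun v =>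
    measurable_adjTerm_condCDF v y
  have hμb : ∀ v, ∀ u : UnitData K M d, |adjTerm (condCDF Q v y) u| ≤ 1 := fun v u =>
    abs_condCDF_le v y _ _
  have hem : ∀ v, Measurable (e v) := fun v => (hD v).sub (hμ v)
  have heb : ∀ v u, |e v u| ≤ 2 := fun v u => (abs_sub _ _).trans (by
    linarith [abs_outcomeInd_le v y u, hμb v u])
  have hkm : ∀ v, Measurable (k v) := fun v => by
    have h1 : Measurable fun x : Fin M × (Fin d → ℝ) => condCDF Q v y x.1 x.2 :=
      (Kernel.measurable_coe (condDistrib (fun u : UnitData K M d => u.1 v)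
        (fun u : UnitData K M d => u.2) Q) measurableSet_Iic).ennreal_toReal
    exact h1.sub ((measurable_of_finite (stratumMean Q (adjTerm (condCDF Q v y)))).comp measurable_fst)
  have hkm' : ∀ v, Measurable fun u : UnitData K M d => k v u.2 := fun v =>
    (hkm v).comp measurable_snd
  have hkb : ∀ v x, |k v x| ≤ 2 := fun v x => (abs_sub _ _).trans (by
    linarith [abs_condCDF_le (Q := Q) v y x.1 x.2, abs_stratumMean_le Q zero_le_one (hμb v) x.1])
  have hiD : ∀ v s, Integrable (outcomeInd v y) (Q[|{u | u.2.1 = s}]) := fun v s =>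
    integrable_of_abs_le _ (hD v) (abs_outcomeInd_le v y)
  have hiμ : ∀ v s, Integrable (adjTerm (condCDF Q v y)) (Q[|{u | u.2.1 = s}]) := fun v s =>
    integrable_of_abs_le _ (hμ v) (hμb v)
  have hmeanD : ∀ v s, stratumMean Q (outcomeInd v y) s
      = stratumMean Q (adjTerm (condCDF Q v y)) s := fun v s => by
    have := stratumMean_outcomeInd_sub_condCDF (Q := Q) v y s
    rw [stratumMean_sub Q (hiD v s) (hiμ v s)] at this
    linarith
  have hce : ∀ v u, centered Q (fun u => outcomeInd v y u - adjTerm (condCDF Q v y) u) u = e v u :=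
    fun v u => by simp only [centered, stratumMean_outcomeInd_sub_condCDF, sub_zero, e]
  have hcg : ∀ u, centered Q (fun u => adjTerm (condCDF Q w y) u - adjTerm (condCDF Q w' y) u) u
      = k w u.2 - k w' u.2 := fun u => by
    rw [centered, stratumMean_sub Q (hiμ w _) (hiμ w' _)]
    simp only [k, adjTerm]
    ring
  have hcD : ∀ v u, centered Q (fun u => outcomeInd v y u - adjTerm (fun _ _ => 0) u) u
      = e v u + k v u.2 := fun v u => by
    simp only [centered, adjTerm, sub_zero, e, k]
    have := hmeanD v u.2.1
    change outcomeInd v y u - stratumMean Q (outcomeInd v y) u.2.1 = _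
    rw [this]
    ring
  have hc0 : ∀ u : UnitData K M d,
      centered Q (fun u => adjTerm (fun _ _ => 0) u - adjTerm (fun _ _ => 0) u) u = 0 := fun u => by
    simp [centered, stratumMean, adjTerm]
  -- The residual `e` is already centered in each stratum. The adjusted score therefore weights only
  -- `e` and carries `k w - k w'` unweighted, while the empirical score weights `e + k`.
  simp only [score, hce, hcg, hcD, hc0, add_zero]
  change ∑ v, π v s * ∫ u in {u | u.2.1 = s}, (α w v * e w u - α w' v * e w' u
        + (k w u.2 - k w' u.2)) ^ 2 ∂Q
      ≤ ∑ v, π v s * ∫ u in {u | u.2.1 = s}, (α w v * (e w u + k w u.2)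
        - α w' v * (e w' u + k w' u.2)) ^ 2 ∂Q
  have hint : ∀ (f : UnitData K M d → ℝ) (C : ℝ), Measurable f → (∀ u, |f u| ≤ C) →
      IntegrableOn f {u | u.2.1 = s} Q := fun f C hf hC => integrable_of_abs_le _ hf hC
  have hlin : ∀ a b : ℝ, ∀ x, |a * k w x - b * k w' x| ≤ |a| * 2 + |b| * 2 := fun a b x => by
    refine (abs_sub _ _).trans (add_le_add ?_ ?_) <;> rw [abs_mul] <;> gcongr <;> exact hkb _ _
  have hsq' : ∀ v, IntegrableOn (fun u : UnitData K M d => (α w v * k w u.2 - α w' v * k w' u.2) ^ 2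
        - (k w u.2 - k w' u.2) ^ 2) {u | u.2.1 = s} Q := by
    intro v
    refine hint _ ((|α w v| * 2 + |α w' v| * 2) ^ 2 + 4 ^ 2) ?_ fun u => ?_
    · have h3 := hkm' w
      have h4 := hkm' w'
      exact (((h3.const_mul _).sub (h4.const_mul _)).pow_const 2).sub
        ((h3.sub h4).pow_const 2)
    · refine (abs_sub _ _).trans (add_le_add ?_ ?_) <;> rw [abs_pow] <;> gcongr
      · exact hlin _ _ _
      · refine (abs_sub _ _).trans ?_
        linarith [hkb w u.2, hkb w' u.2]
  -- the difference of the integrals for one treatment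
  have hdiff : ∀ v, ∫ u in {u | u.2.1 = s}, (α w v * (e w u + k w u.2)
        - α w' v * (e w' u + k w' u.2)) ^ 2 ∂Q
      = (∫ u in {u | u.2.1 = s}, (α w v * e w u - α w' v * e w' u
        + (k w u.2 - k w' u.2)) ^ 2 ∂Q)
        + ∫ u in {u | u.2.1 = s}, ((α w v * k w u.2 - α w' v * k w' u.2) ^ 2
          - (k w u.2 - k w' u.2) ^ 2) ∂Q := by
    intro v
    -- The coefficient of the residual part when the two squares are subtracted: twice the
    -- difference of the `k` parts. It depends on stratum and covariates only, hence is orthogonal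
    -- to both residuals.
    let r : Fin M × (Fin d → ℝ) → ℝ := fun x =>
      2 * ((α w v * k w x - α w' v * k w' x) - (k w x - k w' x))
    have hrm : Measurable r := by
      have h1 := hkm w
      have h2 := hkm w'
      fun_prop
    have hrb : ∀ x, |r x| ≤ 2 * ((|α w v| * 2 + |α w' v| * 2) + 4) := fun x => by
      simp only [r]
      rw [abs_mul, abs_two]
      gcongr
      refine (abs_sub _ _).trans (add_le_add (hlin _ _ _) ?_)
      refine (abs_sub _ _).trans ?_
      linarith [hkb w x, hkb w' x]
    have o₁ := setIntegral_mul_outcomeInd_sub_condCDF (Q := Q) w y s hrm hrb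
    have o₂ := setIntegral_mul_outcomeInd_sub_condCDF (Q := Q) w' y s hrm hrb
    have hre : ∀ x, IntegrableOn (fun u => r u.2 * e x u) {u | u.2.1 = s} Q := fun x => by
      refine hint _ (2 * ((|α w v| * 2 + |α w' v| * 2) + 4) * 2)
        ((hrm.comp measurable_snd).mul (hem x)) fun u => ?_
      rw [abs_mul]
      exact mul_le_mul (hrb _) (heb _ _) (abs_nonneg _) (by positivity)
    have hsq : IntegrableOn (fun u => (α w v * e w u - α w' v * e w' u
        + (k w u.2 - k w' u.2)) ^ 2) {u | u.2.1 = s} Q := by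
      refine hint _ ((|α w v| * 2 + |α w' v| * 2 + 4) ^ 2) ?_ fun u => ?_
      · have h1 := hem w
        have h2 := hem w'
        have h3 := hkm' w
        have h4 := hkm' w'
        exact (((h1.const_mul _).sub (h2.const_mul _)).add (h3.sub h4)).pow_const 2
      · rw [abs_pow]
        gcongr
        refine (abs_add_le _ _).trans (add_le_add ((abs_sub _ _).trans (add_le_add ?_ ?_)) ?_)
        · rw [abs_mul]; gcongr; exact heb _ _
        · rw [abs_mul]; gcongr; exact heb _ _
        · refine (abs_sub _ _).trans ?_
          linarith [hkb w u.2, hkb w' u.2]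
    have hpoint : ∀ u, (α w v * (e w u + k w u.2) - α w' v * (e w' u + k w' u.2)) ^ 2
        = ((α w v * e w u - α w' v * e w' u + (k w u.2 - k w' u.2)) ^ 2
          + ((α w v * k w u.2 - α w' v * k w' u.2) ^ 2 - (k w u.2 - k w' u.2) ^ 2))
          + (α w v * (r u.2 * e w u) - α w' v * (r u.2 * e w' u)) := fun u => by
      simp only [r]
      ring
    simp only [hpoint]
    have hsum : Integrable (fun u => (α w v * e w u - α w' v * e w' u + (k w u.2 - k w' u.2)) ^ 2
        + ((α w v * k w u.2 - α w' v * k w' u.2) ^ 2 - (k w u.2 - k w' u.2) ^ 2))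
        (Q.restrict {u | u.2.1 = s}) := hsq.add (hsq' v)
    rw [integral_add hsum (((hre w).const_mul _).sub' ((hre w').const_mul _)),
      integral_add hsq (hsq' v), integral_sub ((hre w).const_mul _) ((hre w').const_mul _),
      integral_const_mul, integral_const_mul, o₁, o₂]
    ring
  rw [Finset.sum_congr rfl fun v _ => (congrArg (π v s * ·) (hdiff v)).trans (mul_add _ _ _),
    Finset.sum_add_distrib]
  refine le_add_of_nonneg_right ?_
  simp only [← integral_const_mul]
  rw [← integral_finsetSum _ fun v _ => (hsq' v).const_mul _]
  -- The inequality holds pointwise in `u`, with the target probabilities as weights. The mean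
  -- condition holds because `∑ v, π v s * α x v = 1`, so the weighted contrast averages to `k w - k
  -- w'`.
  refine integral_nonneg fun u => sum_mul_sq_sub_sq_nonneg (fun v => (hE.target_mem v s).1.le)
    (hE.sum_target_eq_one s) ?_
  have hα : ∀ x (a : ℝ), ∑ v, π v s * (α x v * a) = a := fun x a => by
    have hx := (hE.target_mem x s).1.ne'
    simp [α, hx]
  simp only [mul_sub, Finset.sum_sub_distrib, hα]

end

end CAR

theorem corollary1 {Ω : Type*} [MeasurableSpace Ω] (P : Measure Ω) [IsProbabilityMeasure P]
    {K M d : ℕ} (E : CAR.Experiment Ω K M d)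
    (Q : Measure (CAR.UnitData K M d)) [IsProbabilityMeasure Q]
    (π : Fin K → Fin M → ℝ) (hE : E.IsCAR P Q π) (w w' : Fin K) (y : ℝ) :
    ∃ Vadj Vemp : ℝ≥0,
      CAR.HasAsymptoticVariance P (E.dteAdj Q w w' y) (CAR.dte Q w w' y) Vadj ∧
      CAR.HasAsymptoticVariance P (E.dteEmp w w' y) (CAR.dte Q w w' y) Vemp ∧
      Vadj ≤ Vemp := by
  have hadj := CAR.hasAsymptoticVariance_cdfAIPW_sub hE (CAR.measurable_adjTerm_condCDF (Q := Q) w y)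
    (CAR.measurable_adjTerm_condCDF (Q := Q) w' y) zero_le_one (CAR.abs_condCDF_le w y)
    (CAR.abs_condCDF_le w' y) w w' y
  have hemp := CAR.hasAsymptoticVariance_cdfAIPW_sub hE (m₁ := fun _ _ => 0) (m₂ := fun _ _ => 0)
    measurable_const measurable_const zero_le_one (by simp) (by simp) w w' y
  have heq : E.dteEmp w w' y = fun n ω => E.cdfAIPW (fun _ _ => 0) n w y ω
      - E.cdfAIPW (fun _ _ => 0) n w' y ω := by
    ext n ω
    rw [CAR.Experiment.dteEmp, CAR.cdfEmp_eq_cdfAIPW, CAR.cdfEmp_eq_cdfAIPW]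
  rw [← heq] at hemp
  exact ⟨_, _, hadj, hemp, Real.toNNReal_le_toNNReal (CAR.limitVariance_condCDF_le hE w w' y _)⟩
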